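/- **List machines.** A *nondeterministic list machine* (NLM) is a tuple $M=(t,m,I,C,A,a_0,\alpha,B,B_{\mathrm{acc}})$, where $t$ is the number of lists, $m$ is the input length, $I$ (input numbers), $C$ (nondeterministic choices) and $A$ (states) are finite sets, $a_0\in A$ is the initial state, $B_{\mathrm{acc}}\subseteq B\subseteq A$ are the accepting and the final states, and $$\alpha:(A\setminus B)\times(\mathbb A^*)^t\times C\to A\times(\{-1,+1\}\times\{\mathrm{true},\mathrm{false}\})^t$$ is the transition function; here $\mathbb A=I\cup C\cup A\cup\{\langle,\rangle\}$ is the alphabet (a disjoint union). A *configuration* $(a,p,d,X)$ consists of a state $a$, and for each list $i\le t$ a head position $p_i$, a head direction $d_i\in\{-1,+1\}$ and a nonempty sequence of cells $x_i=(x_{i,1},\dots,x_{i,m_i})$ with $x_{i,j}\in\mathbb A^*$. In the *initial configuration* for input $(v_1,\dots,v_m)\in I^m$ the state is $a_0$, all $p_i=1$, all $d_i=+1$, $x_1=(\langle v_1\rangle,\dots,\langle v_m\rangle)$ and $x_i=(\langle\rangle)$ for $i\ge2$. The *$c$-successor* ($c\in C$) of a configuration with $a\notin B$ is defined as follows. Let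 $\alpha(a,x_{1,p_1},\dots,x_{t,p_t},c)=(b,e_1,\dots,e_t)$. Let $e_i'=(h_i,\mathit{move}_i)$ be $(-1,\mathrm{false})$ if $p_i=1$ and $e_i=(-1,\mathrm{true})$, be $(+1,\mathrm{false})$ if $p_i=m_i$ and $e_i=(+1,\mathrm{true})$, and be $e_i$ otherwise. The new state is $b$. If $\mathit{move}_i=\mathrm{false}$ and $h_i=d_i$ for all $i$, nothing else changes. Otherwise let $y=a\langle x_{1,p_1}\rangle\cdots\langle x_{t,p_t}\rangle\langle c\rangle$. For every $i$: if $\mathit{move}_i=\mathrm{true}$, the cell $x_{i,p_i}$ is replaced by $y$; if $\mathit{move}_i=\mathrm{false}$, a new cell $y$ is inserted immediately before $x_{i,p_i}$ when $d_i=+1$ and immediately after it when $d_i=-1$. The new direction is $h_i$, and the new head position is $p_i+1$ if $e'_i=(+1,\mathrm{true})$ or $e_i'=(+1,\mathrm{false})$, $p_i-1$ if $e_i'=(-1,\mathrm{true})$, and $p_i$ if $e_i'=(-1,\mathrm{false})$. A (finite) *run* on an input is a sequence $\rho=(\rho_1,\dots,\rho_\ell)$ of configurations such that $\rho_1$ is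 the initial configuration, $\rho_\ell$ is final (its state is in $B$), and each $\rho_{i+1}$ is the $c$-successor of $\rho_i$ for some $c\in C$; it is *accepting* if the state of $\rho_\ell$ is in $B_{\mathrm{acc}}$. Let $\mathrm{rev}(\rho,\tau)$ be the number of changes of the direction of the head of list $\tau$ in $\rho$. $M$ is *$(r,t)$-bounded* if it has at most $t$ lists, has no infinite run, and $1+\sum_\tau\mathrm{rev}(\rho,\tau)\le r$ for every run $\rho$. The probability of a step $\gamma\to\gamma'$ is $|\{c\in C:\gamma'\text{ is the }c\text{-successor of }\gamma\}|/|C|$, the probability of a run is the product of the probabilities of its steps, and $\Pr(M\text{ accepts }\vec v)$ is the sum of the probabilities of the accepting runs of $M$ on $\vec v$. The *sortedness* of a permutation $\pi$ of $\{1,\dots,m\}$ is the length of the longest subsequence of $(\pi(1),\dots,\pi(m))$ that is sorted in ascending or in descending order. **Lemma (Lower Bound for List Machines).** Let $k,m,n,r,t\in\mathbb N$ be such that $m$ is a power of $2$, $t\ge2$, $m\ge24(t+1)^{4r}+1$, $k\ge2m+3$ and $n\ge1+(m^2+1)\log_2(2k)$. Let $I=\{0,1\}^n$, identify $I$ with $\{0,1,\dots,2^n-1\}$,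 and divide it into $m$ consecutive intervals $I_1,\dots,I_m$, each of length $2^n/m$. Let $\varphi$ be a permutation of $\{1,\dots,m\}$ with sortedness at most $2\sqrt m-1$, and let $$\mathcal I=I_{\varphi(1)}\times\cdots\times I_{\varphi(m)}\times I_1\times\cdots\times I_m.$$ Then there is no $(r,t)$-bounded NLM $M=(t,2m,I,C,A,a_0,\alpha,B,B_{\mathrm{acc}})$ with $|A|\le k$ and $I=\{0,1\}^n$ such that for all $\vec v=(v_1,\dots,v_m,v_1',\dots,v_m')\in\mathcal I$ the following holds: if $(v_1,\dots,v_m)=(v'_{\varphi(1)},\dots,v'_{\varphi(m)})$, then $\Pr(M\text{ accepts }\vec v)\ge\frac12$; otherwise $\Pr(M\text{ accepts }\vec v)=0$. -/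

import Mathlib

open scoped ENNReal

/-- The sortedness of a permutation `π` of `{1,…,m}`: the length of the longest subsequence
`(π (j 1), …, π (j l))`, `j 1 < ⋯ < j l`, of `(π 1, …, π m)` that is sorted in ascending or in
descending order. -/
noncomputable def sortedness {m : ℕ} (π : Equiv.Perm (Fin m)) : ℕ :=
  sSup {l : ℕ | ∃ j : Fin l → Fin m, StrictMono j ∧ (StrictMono (π ∘ j) ∨ StrictAnti (π ∘ j))}

/-- The set of lengths in the definition of `sortedness` is bounded, so the supremum is the
maximum. -/
theorem sortedness_bddAbove {m : ℕ} (π : Equiv.Perm (Fin m)) :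
    BddAbove {l : ℕ | ∃ j : Fin l → Fin m,
      StrictMono j ∧ (StrictMono (π ∘ j) ∨ StrictAnti (π ∘ j))} := by
  refine ⟨m, ?_⟩
  rintro l ⟨j, hj, -⟩
  simpa using Fintype.card_le_of_injective j hj.injective

/-- The `j`-th of the `m` consecutive intervals of length `2 ^ n / m` into which
`{0,1}^n = {0, …, 2 ^ n - 1}` is divided: all `x` with `j * (2^n/m) ≤ x < (j+1) * (2^n/m)`
(`j` counted from `0`). -/
def inputInterval (n m : ℕ) (j : Fin m) : Set (BitVec n) :=
  {x | (j : ℕ) * 2 ^ n ≤ m * x.toNat ∧ m * x.toNat < ((j : ℕ) + 1) * 2 ^ n}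

/-- Head directions: `left` is `-1`, `right` is `+1`. -/
inductive HeadDir where
  | left : HeadDir
  | right : HeadDir
  deriving DecidableEq

/-- The alphabet `I ∪ C ∪ A ∪ {⟨, ⟩}` (a disjoint union) of a list machine. -/
inductive LMSymbol (I C A : Type*) where
  | input : I → LMSymbol I C A
  | choice : C → LMSymbol I C A
  | state : A → LMSymbol I C A
  | langle : LMSymbol I C A
  | rangle : LMSymbol I C A

/-- A nondeterministic list machine `(t, m, I, C, A, a₀, α, B, B_acc)`. -/
structure NLM (t m : ℕ) (I C A : Type*) where
  /-- the initial state `a₀` -/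
  start : A
  /-- the set `B` of final states -/
  final : Set A
  /-- the set `B_acc` of accepting states -/
  acc : Set A
  acc_subset : acc ⊆ final
  /-- the transition function `α`; a movement is a pair (head-direction, move) -/
  trans : {a : A // a ∉ final} → (Fin t → List (LMSymbol I C A)) → C →
    A × (Fin t → HeadDir × Bool)

/-- Configurations `(a, p, d, X)` of a list machine. Head positions are counted from `0`. -/
structure LMConfig (t : ℕ) (I C A : Type*) where
  state : A
  pos : Fin t → ℕ
  dir : Fin t → HeadDir
  lists : Fin t → List (List (LMSymbol I C A))

namespace LMConfig

variable {t : ℕ} {I C A : Type*}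

/-- The content of the cell of list `τ` on which the head stands. -/
def cell (γ : LMConfig t I C A) (τ : Fin t) : List (LMSymbol I C A) :=
  (γ.lists τ).getD (γ.pos τ) []

/-- The movement `e'` obtained from `e`: a head at an end of its list stays there instead of
falling off. -/
def clip (γ : LMConfig t I C A) (e : Fin t → HeadDir × Bool) (τ : Fin t) : HeadDir × Bool :=
  if γ.pos τ = 0 ∧ e τ = (HeadDir.left, true) then (HeadDir.left, false)
  else if γ.pos τ + 1 = (γ.lists τ).length ∧ e τ = (HeadDir.right, true) then
    (HeadDir.right, false)
  else e τ

/-- The string `y = a ⟨x₁⟩ ⋯ ⟨x_t⟩ ⟨c⟩` that is written in a step with choice `c`. -/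
def written (γ : LMConfig t I C A) (c : C) : List (LMSymbol I C A) :=
  [LMSymbol.state γ.state] ++
    (List.ofFn fun τ => [LMSymbol.langle] ++ γ.cell τ ++ [LMSymbol.rangle]).flatten ++
    [LMSymbol.langle, LMSymbol.choice c, LMSymbol.rangle]

/-- The new content of a list `x` after writing `y`, where the head stands on cell `p`, has
direction `d`, and does (`move = true`) or does not (`move = false`) move on: `y` replaces the
current cell, or is inserted behind the head. -/
def writeList (x : List (List (LMSymbol I C A))) (p : ℕ) (d : HeadDir) (move : Bool)
    (y : List (LMSymbol I C A)) : List (List (LMSymbol I C A)) :=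
  match move, d with
  | true, _ => x.set p y
  | false, HeadDir.right => x.insertIdx p y
  | false, HeadDir.left => x.insertIdx (p + 1) y

/-- The new position of a head on cell `p` after the (clipped) movement. -/
def newPos (p : ℕ) : HeadDir × Bool → ℕ
  | (HeadDir.right, true) => p + 1
  | (HeadDir.left, true) => p - 1
  | (HeadDir.right, false) => p + 1
  | (HeadDir.left, false) => p

open scoped Classical in
/-- The configuration reached from `γ` in one step with choice `c`, new state `b` and
movements `e`. If no head moves or changes its direction, then only the state changes. -/
noncomputable def update (γ : LMConfig t I C A) (c : C) (b : A) (e : Fin t → HeadDir × Bool) :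
    LMConfig t I C A :=
  if ∃ τ, (γ.clip e τ).2 = true ∨ (γ.clip e τ).1 ≠ γ.dir τ then
    { state := b
      pos := fun τ => newPos (γ.pos τ) (γ.clip e τ)
      dir := fun τ => (γ.clip e τ).1
      lists := fun τ =>
        writeList (γ.lists τ) (γ.pos τ) (γ.dir τ) (γ.clip e τ).2 (γ.written c) }
  else
    { γ with state := b }

/-- The number of changes of the direction of the head of list `τ` in the sequence `ρ` of
configurations. -/
def rev (ρ : List (LMConfig t I C A)) (τ : Fin t) : ℕ :=
  (ρ.zip ρ.tail).countP fun q => decide (q.1.dir τ ≠ q.2.dir τ)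

end LMConfig

namespace NLM

variable {t m : ℕ} {I C A : Type*}

/-- The initial configuration for input `v`: the first list is `(⟨v 1⟩, …, ⟨v m⟩)`, every other
list is `(⟨⟩)`, and all heads stand on the first cell with direction `+1`. -/
def init (M : NLM t m I C A) (v : Fin m → I) : LMConfig t I C A where
  state := M.start
  pos := fun _ => 0
  dir := fun _ => HeadDir.right
  lists := fun τ =>
    if (τ : ℕ) = 0 then
      List.ofFn fun i => [LMSymbol.langle, LMSymbol.input (v i), LMSymbol.rangle]
    else [[LMSymbol.langle, LMSymbol.rangle]]

/-- `γ'` is the `c`-successor of the (non-final) configuration `γ`. -/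
def IsSucc (M : NLM t m I C A) (c : C) (γ γ' : LMConfig t I C A) : Prop :=
  ∃ h : γ.state ∉ M.final,
    γ' = γ.update c (M.trans ⟨γ.state, h⟩ γ.cell c).1 (M.trans ⟨γ.state, h⟩ γ.cell c).2

/-- `ρ` is a (finite) run of `M` on input `v`: it starts in the initial configuration, ends in a
final configuration, and each configuration is a `c`-successor, for some choice `c`, of the one
before it. -/
def IsRun (M : NLM t m I C A) (v : Fin m → I) (ρ : List (LMConfig t I C A)) : Prop :=
  ρ.head? = some (M.init v) ∧
    ρ.IsChain (fun γ γ' => ∃ c, M.IsSucc c γ γ') ∧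
    ∃ γ, ρ.getLast? = some γ ∧ γ.state ∈ M.final

/-- `ρ` is an accepting run of `M` on input `v`. -/
def IsAcceptingRun (M : NLM t m I C A) (v : Fin m → I) (ρ : List (LMConfig t I C A)) : Prop :=
  M.IsRun v ρ ∧ ∃ γ, ρ.getLast? = some γ ∧ γ.state ∈ M.acc

/-- `ρ` is an infinite run of `M` on input `v`. -/
def IsInfiniteRun (M : NLM t m I C A) (v : Fin m → I) (ρ : ℕ → LMConfig t I C A) : Prop :=
  ρ 0 = M.init v ∧ ∀ i, ∃ c, M.IsSucc c (ρ i) (ρ (i + 1))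

/-- `M` is `(r, t')`-bounded: it has at most `t'` lists, every run is finite, and
`1 + ∑ τ, rev (ρ, τ) ≤ r` for every run `ρ`. -/
def IsBounded (M : NLM t m I C A) (r t' : ℕ) : Prop :=
  t ≤ t' ∧
    (∀ (v : Fin m → I) (ρ : ℕ → LMConfig t I C A), ¬ M.IsInfiniteRun v ρ) ∧
    ∀ (v : Fin m → I) (ρ : List (LMConfig t I C A)), M.IsRun v ρ →
      1 + ∑ τ, LMConfig.rev ρ τ ≤ r

/-- The probability that `γ` yields `γ'` in one step. -/
noncomputable def stepProb (M : NLM t m I C A) (γ γ' : LMConfig t I C A) : ℝ≥0∞ :=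
  (Set.ncard {c : C | M.IsSucc c γ γ'} : ℝ≥0∞) / (Nat.card C : ℝ≥0∞)

/-- The probability that `M` performs the run `ρ`. -/
noncomputable def runProb (M : NLM t m I C A) (ρ : List (LMConfig t I C A)) : ℝ≥0∞ :=
  ((ρ.zip ρ.tail).map fun q => M.stepProb q.1 q.2).prod

/-- The probability that `M` accepts the input `v`. -/
noncomputable def acceptProb (M : NLM t m I C A) (v : Fin m → I) : ℝ≥0∞ :=
  ∑' ρ : {ρ : List (LMConfig t I C A) // M.IsAcceptingRun v ρ}, M.runProb ρ.1

end NLM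

/-! A list machine only copies input values; states and head movements decide which positions end up
together. Describe each step by its signature: the new state and, for each head, whether it turns
and moves, or `none` if nothing is written. The signatures alone determine which input positions
meet in which cell (`shadowRun`).

Few positions meet. Between two steps with a turn, in a phase, every head reads in one direction
cells stemming from before that phase, so what is copied from a fixed list keeps its order. Color an
occurrence of an input position by the list it was copied from in each phase, if any. There are
(t+1)^r colors, a cell holds at most one position of each color, and the entries of one color form a
sorted row (`Shadow.Ordered`). For a fixed pair of colors, the indices i whose positions i and
m+φ(i) share a cell with these colors form a monotone subsequence of φ. So at most (t+1)^(2r) ·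
`sortedness φ` < m indices are affected, and for some i the two positions never meet
(`exists_not_occurs`).

There are few signature sequences. A potential bounds the number of writing steps by (t+1)^r ·
(2m+t), and fewer than |A| steps without writing precede each of them, since a repeated state would
close a loop (`exists_code`).

Averaging fixes one choice sequence that accepts at least half of the yes-instances. With q = 2^n/m,
more than q^(m-1) of these share one signature sequence, and two of them differ only in the value
with index φ(i), for an i whose pair never meets. Combine the first half of one with the second half
of the other. At every time the heads miss one of the two altered positions, so the mixed input
behaves like one of the two originals (`state_traj_of_mixed_input`). It is therefore accepted,
although it is a no-instance. -/

/-! ### Lists seen from their heads -/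

/-- A list with a marked cell, read in the direction of the head: the cells behind the head,
nearest first, and the cells from the head on. -/
abbrev Zipper (α : Type*) := List α × List α

namespace Zipper

variable {α β : Type*}

/-- Write `y` behind the head; the flags say whether the head turns and whether it moves. -/
def write (y : α) : Bool × Bool → Zipper α → Zipper α
  | (false, true), z => (y :: z.1, z.2.tail)
  | (false, false), z => (y :: z.1, z.2)
  | (true, true), z => (y :: z.2.tail, z.1)
  -- The new cell lies just behind the old head position, so a head that turns without moving stands
  -- on it.
  | (true, false), z => (z.2, y :: z.1)

/-- Apply a function to all cells. -/
def map (f : α → β) (z : Zipper α) : Zipper β := (z.1.map f, z.2.map f)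

theorem map_write (f : α → β) (y : α) (g : Bool × Bool) (z : Zipper α) :
    (z.write y g).map f = (z.map f).write (f y) g := by
  rcases g with ⟨_ | _, _ | _⟩ <;> simp [write, map, List.map_tail]

/-- `x` is one of the cells. -/
def Mem (x : α) (z : Zipper α) : Prop := x ∈ z.1 ∨ x ∈ z.2

theorem mem_write {x y : α} {g : Bool × Bool} {z : Zipper α} (h : (z.write y g).Mem x) :
    x = y ∨ z.Mem x := by
  have ht : x ∈ z.2.tail → x ∈ z.2 := List.mem_of_mem_tail
  rcases g with ⟨_ | _, _ | _⟩ <;> simp only [write, Mem, List.mem_cons] at h ⊢ <;> tauto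

/-- The zipper of the list `x` with the head on cell `p` in direction `d`. -/
def ofList (x : List α) (p : ℕ) : HeadDir → Zipper α
  | HeadDir.right => ((x.take p).reverse, x.drop p)
  | HeadDir.left => (x.drop (p + 1), (x.take (p + 1)).reverse)

/-- The flags of the movement `e` of a head with direction `d`, with `b` cells behind it and
`f` cells from it on. -/
def flags (d : HeadDir) (e : HeadDir × Bool) (b f : ℕ) : Bool × Bool :=
  (decide (e.1 ≠ d), e.2 && if e.1 = d then decide (f ≠ 1) else decide (b ≠ 0))

end Zipper

namespace LMConfig

variable {t : ℕ} {I C A : Type*}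

/-- All heads stand on cells of their lists. -/
def WellFormed (γ : LMConfig t I C A) : Prop := ∀ τ, γ.pos τ < (γ.lists τ).length

/-- The list `τ` as a zipper. -/
def zipper (γ : LMConfig t I C A) (τ : Fin t) : Zipper (List (LMSymbol I C A)) :=
  Zipper.ofList (γ.lists τ) (γ.pos τ) (γ.dir τ)

theorem WellFormed.ahead_ne_nil {γ : LMConfig t I C A} (h : γ.WellFormed) (τ : Fin t) :
    (γ.zipper τ).2 ≠ [] := by
  have := h τ
  unfold zipper
  cases γ.dir τ <;> simp only [Zipper.ofList, ne_eq, List.drop_eq_nil_iff, List.reverse_eq_nil_iff,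
    List.take_eq_nil_iff, not_le, not_or] <;> first | exact this | skip
  refine ⟨by omega, ?_⟩
  rintro h0
  simp [h0] at this

theorem WellFormed.cell_eq {γ : LMConfig t I C A} (h : γ.WellFormed) (τ : Fin t) :
    γ.cell τ = (γ.zipper τ).2.headD [] := by
  have := h τ
  unfold zipper cell
  rw [List.headD_eq_head?_getD, List.getD_eq_getElem?_getD]
  cases γ.dir τ <;> simp only [Zipper.ofList]
  · rw [List.head?_reverse, List.getLast?_take]
    simp [this]
  · rw [List.head?_drop]

/-- Clipping depends on the position only through the numbers of cells behind and ahead, which makes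
it comparable between configurations with different contents. -/
theorem WellFormed.clip_flags {γ : LMConfig t I C A} (h : γ.WellFormed)
    (e : Fin t → HeadDir × Bool) (τ : Fin t) :
    (decide ((γ.clip e τ).1 ≠ γ.dir τ), (γ.clip e τ).2) =
      Zipper.flags (γ.dir τ) (e τ) (γ.zipper τ).1.length (γ.zipper τ).2.length := by
  have := h τ
  unfold zipper clip Zipper.flags
  rcases hd : γ.dir τ <;> rcases he : e τ with ⟨_ | _, _ | _⟩ <;>
    simp [Zipper.ofList] <;> split_ifs <;> simp <;>
    first | omega | exact ⟨‹_›, fun h => by simp [h] at this⟩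

end LMConfig

namespace Zipper

variable {α : Type*}

theorem ofList_right {x l : List α} {a : α} {r : List α} {p : ℕ} (hx : x = l ++ a :: r)
    (hp : p = l.length) : ofList x p HeadDir.right = (l.reverse, a :: r) := by
  subst hx hp
  simp [ofList]

theorem ofList_left {x l : List α} {a : α} {r : List α} {p : ℕ} (hx : x = l ++ a :: r)
    (hp : p = l.length) : ofList x p HeadDir.left = (r, a :: l.reverse) := by
  subst hx hp
  simp [ofList, List.take_append, List.drop_append]

end Zipper

namespace LMConfig

variable {t : ℕ} {I C A : Type*}

theorem insertIdx_append_length {α : Type*} (l r : List α) (y : α) :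
    (l ++ r).insertIdx l.length y = l ++ y :: r := by
  induction l <;> simp_all

/-- Reading a list in the direction of its head removes the distinction between left and right. The
hypotheses `h0` and `h1` say that the movement is already clipped. -/
theorem ofList_writeList {x : List (List (LMSymbol I C A))} {p : ℕ} (hp : p < x.length)
    (d h : HeadDir) (mv : Bool) (y : List (LMSymbol I C A))
    (h0 : (h, mv) = (HeadDir.left, true) → p ≠ 0)
    (h1 : (h, mv) = (HeadDir.right, true) → p + 1 ≠ x.length) :
    newPos p (h, mv) < (writeList x p d mv y).length ∧
    Zipper.ofList (writeList x p d mv y) (newPos p (h, mv)) h =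
      (Zipper.ofList x p d).write y (decide (h ≠ d), mv) := by
  obtain ⟨l, a, r, rfl, rfl⟩ : ∃ l a r, x = l ++ a :: r ∧ p = l.length :=
    ⟨x.take p, x[p], x.drop (p + 1), by simp, by simp; omega⟩
  have i1 := insertIdx_append_length l (a :: r) y
  have i2 := insertIdx_append_length (l ++ [a]) r y
  simp only [List.append_assoc, List.cons_append, List.nil_append, List.length_append,
    List.length_cons, List.length_nil, zero_add] at i2
  have s1 : (l ++ a :: r).set l.length y = l ++ y :: r := by
    rw [List.set_append_right _ _ le_rfl]; simp
  have oR := Zipper.ofList_right (x := l ++ a :: r) rfl rfl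
  have oL := Zipper.ofList_left (x := l ++ a :: r) rfl rfl
  cases mv
  · cases d <;> cases h <;> simp only [writeList, newPos, oR, oL, i1, i2]
    · rw [Zipper.ofList_left rfl rfl]
      simp [Zipper.write]
    · rw [Zipper.ofList_right (l := l ++ [a]) (a := y) (r := r) (by simp) (by simp)]
      simp [Zipper.write]
    · rw [Zipper.ofList_left rfl rfl]
      simp [Zipper.write]
    · rw [Zipper.ofList_right (l := l ++ [y]) (a := a) (r := r) (by simp) (by simp)]
      simp [Zipper.write]
  · cases h
    · obtain ⟨l, b, rfl⟩ : ∃ l' b, l = l' ++ [b] := by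
        rcases List.eq_nil_or_concat l with rfl | ⟨l, b, rfl⟩
        · simp at h0
        · exact ⟨l, b, by simp⟩
      cases d <;> simp only [writeList, newPos, oR, oL, s1] <;>
        rw [Zipper.ofList_left (l := l) (a := b) (r := y :: r) (by simp) (by simp)] <;>
        simp [Zipper.write]
    · obtain ⟨b, r, rfl⟩ : ∃ b r', r = b :: r' := by
        cases r with
        | nil => simp at h1
        | cons b r => exact ⟨b, r, rfl⟩
      cases d <;> simp only [writeList, newPos, oR, oL, s1] <;>
        rw [Zipper.ofList_right (l := l ++ [y]) (a := b) (r := r) (by simp) (by simp)] <;>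
        simp [Zipper.write]

end LMConfig

/-! ### Steps, signatures and trajectories -/

namespace NLM

variable {t m : ℕ} {I C A : Type*}

open scoped Classical in
/-- The `c`-successor of `γ`, where final configurations are kept. -/
noncomputable def step (M : NLM t m I C A) (c : C) (γ : LMConfig t I C A) : LMConfig t I C A :=
  if h : γ.state ∈ M.final then γ
  else γ.update c (M.trans ⟨γ.state, h⟩ γ.cell c).1 (M.trans ⟨γ.state, h⟩ γ.cell c).2

open scoped Classical in
/-- What a step does apart from writing: the new state, and for each head whether it turns and
whether it moves; `none` if only the state changes or `γ` is final. -/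
noncomputable def signature (M : NLM t m I C A) (c : C) (γ : LMConfig t I C A) :
    Option (A × (Fin t → Bool × Bool)) :=
  if h : γ.state ∈ M.final then none
  else
    if ∃ τ, (γ.clip (M.trans ⟨γ.state, h⟩ γ.cell c).2 τ).2 = true ∨
        (γ.clip (M.trans ⟨γ.state, h⟩ γ.cell c).2 τ).1 ≠ γ.dir τ then
      some ((M.trans ⟨γ.state, h⟩ γ.cell c).1, fun τ =>
        (decide ((γ.clip (M.trans ⟨γ.state, h⟩ γ.cell c).2 τ).1 ≠ γ.dir τ),
          (γ.clip (M.trans ⟨γ.state, h⟩ γ.cell c).2 τ).2))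
    else none

theorem step_of_final {M : NLM t m I C A} {c : C} {γ : LMConfig t I C A}
    (h : γ.state ∈ M.final) : M.step c γ = γ := by simp [step, h]

theorem isSucc_iff {M : NLM t m I C A} {c : C} {γ γ' : LMConfig t I C A} :
    M.IsSucc c γ γ' ↔ γ.state ∉ M.final ∧ γ' = M.step c γ := by
  unfold IsSucc step
  by_cases h : γ.state ∈ M.final <;> simp [h]

theorem step_of_signature_eq_none {M : NLM t m I C A} {c : C} {γ : LMConfig t I C A}
    (h : M.signature c γ = none) :
    M.step c γ = { γ with state := (M.step c γ).state } := by
  unfold signature at h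
  unfold step
  split_ifs at h ⊢ with hf
  · rfl
  · rename_i h'
    rw [LMConfig.update, if_neg h']

theorem zipper_step_of_signature_eq_none {M : NLM t m I C A} {c : C} {γ : LMConfig t I C A}
    (h : M.signature c γ = none) (τ : Fin t) : (M.step c γ).zipper τ = γ.zipper τ := by
  rw [step_of_signature_eq_none h]; rfl

theorem dir_step_of_signature_eq_none {M : NLM t m I C A} {c : C} {γ : LMConfig t I C A}
    (h : M.signature c γ = none) : (M.step c γ).dir = γ.dir := by
  rw [step_of_signature_eq_none h]

theorem step_of_signature_eq_some {M : NLM t m I C A} {c : C} {γ : LMConfig t I C A}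
    (hγ : γ.WellFormed) {a : A} {g : Fin t → Bool × Bool} (h : M.signature c γ = some (a, g)) :
    γ.state ∉ M.final ∧ (M.step c γ).state = a ∧ (∃ τ, g τ ≠ (false, false)) ∧
      (M.step c γ).WellFormed ∧
      ∀ τ, (M.step c γ).zipper τ = (γ.zipper τ).write (γ.written c) (g τ) ∧
        ((M.step c γ).dir τ ≠ γ.dir τ ↔ (g τ).1 = true) := by
  unfold signature at h
  unfold step
  split_ifs at h ⊢ with hf h'
  simp only [Option.some.injEq, Prod.mk.injEq] at h
  obtain ⟨rfl, rfl⟩ := h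
  refine ⟨hf, ?_⟩
  rw [LMConfig.update, if_pos h']
  have key : ∀ τ, _ := fun τ => LMConfig.ofList_writeList (hγ τ) (γ.dir τ)
    (γ.clip (M.trans ⟨γ.state, hf⟩ γ.cell c).2 τ).1
    (γ.clip (M.trans ⟨γ.state, hf⟩ γ.cell c).2 τ).2 (γ.written c)
    (by
      unfold LMConfig.clip
      split_ifs <;> simp_all
      tauto) (by
      unfold LMConfig.clip
      split_ifs <;> simp_all
      tauto)
  refine ⟨rfl, ?_, fun τ => (key τ).1, fun τ => ⟨(key τ).2, by simp⟩⟩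
  obtain ⟨τ, h'⟩ := h'
  refine ⟨τ, fun h => ?_⟩
  rw [Prod.mk.injEq] at h
  simp_all

theorem wellFormed_step {M : NLM t m I C A} {c : C} {γ : LMConfig t I C A}
    (hγ : γ.WellFormed) : (M.step c γ).WellFormed := by
  rcases h : M.signature c γ with _ | ⟨a, g⟩
  · rw [step_of_signature_eq_none h]
    exact hγ
  · exact (step_of_signature_eq_some hγ h).2.2.2.1

/-- The transition sees only the state and the cells under the heads, and clipping only directions
and lengths. Everything else in the lists may differ. -/
theorem step_congr (M : NLM t m I C A) (c : C) {γ γ' : LMConfig t I C A} (hγ : γ.WellFormed)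
    (hγ' : γ'.WellFormed) (hs : γ.state = γ'.state) (hd : γ.dir = γ'.dir)
    (hh : ∀ τ, (γ.zipper τ).2.headD [] = (γ'.zipper τ).2.headD [])
    (h1 : ∀ τ, (γ.zipper τ).1.length = (γ'.zipper τ).1.length)
    (h2 : ∀ τ, (γ.zipper τ).2.length = (γ'.zipper τ).2.length) :
    M.signature c γ = M.signature c γ' ∧ (M.step c γ).state = (M.step c γ').state ∧
      γ.written c = γ'.written c := by
  have hcell : γ.cell = γ'.cell := by
    funext τ
    rw [hγ.cell_eq, hγ'.cell_eq, hh]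
  have hclip : ∀ e τ, γ.clip e τ = γ'.clip e τ := by
    intro e τ
    have e1 := hγ.clip_flags e τ
    have e2 := hγ'.clip_flags e τ
    rw [h1, h2, hd, ← e2, Prod.mk.injEq] at e1
    refine Prod.ext ?_ e1.2
    have := e1.1
    revert this
    cases (γ.clip e τ).1 <;> cases (γ'.clip e τ).1 <;> cases γ'.dir τ <;> simp
  obtain ⟨s, p, d, l⟩ := γ
  obtain ⟨s', p', d', l'⟩ := γ'
  obtain rfl : s = s' := hs
  obtain rfl : d = d' := hd
  refine ⟨?_, ?_, ?_⟩
  · unfold signature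
    simp only [hcell, hclip]
  · unfold step
    simp only [hcell]
    split_ifs
    · rfl
    · simp only [LMConfig.update]
      split_ifs <;> rfl
  · simp only [LMConfig.written, hcell]

/-- The configuration reached from `γ` in `j` steps with the choices `c 0, c 1, …`. -/
noncomputable def traj (M : NLM t m I C A) (c : ℕ → C) (γ : LMConfig t I C A) :
    ℕ → LMConfig t I C A
  | 0 => γ
  | j + 1 => M.step (c j) (traj M c γ j)

theorem traj_succ (M : NLM t m I C A) (c : ℕ → C) (γ : LMConfig t I C A) (j : ℕ) :
    M.traj c γ (j + 1) = M.traj (fun i => c (i + 1)) (M.step (c 0) γ) j := by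
  induction j with
  | zero => rfl
  | succ j ih => rw [traj, ih]; rfl

theorem wellFormed_traj {M : NLM t m I C A} {c : ℕ → C} {γ : LMConfig t I C A}
    (hγ : γ.WellFormed) (j : ℕ) : (M.traj c γ j).WellFormed := by
  induction j with
  | zero => exact hγ
  | succ j ih => exact wellFormed_step ih

theorem traj_of_final {M : NLM t m I C A} {c : ℕ → C} {γ : LMConfig t I C A} {i : ℕ}
    (h : (M.traj c γ i).state ∈ M.final) {j : ℕ} (hij : i ≤ j) :
    M.traj c γ j = M.traj c γ i := by
  induction j, hij using Nat.le_induction with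
  | base => rfl
  | succ j _ ih => rw [traj, ih, step_of_final h]

theorem wellFormed_init (M : NLM t m I C A) (hm : 0 < m) (v : Fin m → I) :
    (M.init v).WellFormed := by
  intro τ
  simp only [init]
  split_ifs <;> simp [hm]

theorem zipper_init (M : NLM t m I C A) (v : Fin m → I) (τ : Fin t) :
    (M.init v).zipper τ = ([], if (τ : ℕ) = 0 then
      List.ofFn fun i => [LMSymbol.langle, LMSymbol.input (v i), LMSymbol.rangle]
    else [[LMSymbol.langle, LMSymbol.rangle]]) := by
  simp [init, LMConfig.zipper, Zipper.ofList]

end NLM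

/-! ### Colors and the flow of input positions -/

/-- A list is sorted in ascending or in descending order, with repetitions allowed. -/
def WeaklySorted {ι : Type*} [Preorder ι] (l : List ι) : Prop :=
  l.Pairwise (· ≤ ·) ∨ l.Pairwise (· ≥ ·)

namespace WeaklySorted

variable {ι : Type*} [Preorder ι] {l l' : List ι}

theorem sublist (h : WeaklySorted l) (hl : l'.Sublist l) : WeaklySorted l' :=
  h.imp (·.sublist hl) (·.sublist hl)

theorem reverse (h : WeaklySorted l) : WeaklySorted l.reverse :=
  h.symm.imp (fun h => List.pairwise_reverse.2 h) (fun h => List.pairwise_reverse.2 h)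

/-- Needed when a head stays on its cell and the same entry is copied again. -/
theorem duplicate {i : ι} (h : WeaklySorted (l ++ i :: l')) :
    WeaklySorted (l ++ i :: i :: l') := by
  refine h.imp ?_ ?_ <;> simp only [List.pairwise_append, List.pairwise_cons, List.mem_cons] <;>
    rintro ⟨h1, ⟨h2, h3⟩, h4⟩ <;> refine ⟨h1, ⟨?_, h2, h3⟩, ?_⟩ <;> grind [le_refl]

end WeaklySorted

/-- A color records, for each phase between two changes of head directions, whether an input
position was copied in this phase, and from which list. -/
abbrev Color (r t : ℕ) := Fin r → Option (Fin t)

/-- The input positions that occur in a cell, at most one of each color. -/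
abbrev ColorCell (ι : Type*) (r t : ℕ) := Color r t → Option ι

/-- The entries of color `κ` in a list of cells. -/
def colorRow {ι : Type*} {r t : ℕ} (κ : Color r t) (l : List (ColorCell ι r t)) : List ι :=
  l.filterMap fun x => x κ

/-- The flow of input positions through the lists of a list machine. -/
structure Shadow (ι : Type*) (r t : ℕ) where
  /-- the lists -/
  zipper : Fin t → Zipper (ColorCell ι r t)
  /-- the number of previous steps in which a head turned -/
  phase : ℕ
  /-- all cells written so far -/
  hist : List (ColorCell ι r t)

section ColorRow

variable {ι : Type*} {r t : ℕ} {κ : Color r t}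

theorem colorRow_append (l l' : List (ColorCell ι r t)) :
    colorRow κ (l ++ l') = colorRow κ l ++ colorRow κ l' := List.filterMap_append

theorem colorRow_cons (x : ColorCell ι r t) (l : List (ColorCell ι r t)) :
    colorRow κ (x :: l) = (x κ).toList ++ colorRow κ l := by
  unfold colorRow
  cases h : x κ <;> simp [h]

theorem colorRow_reverse (l : List (ColorCell ι r t)) :
    colorRow κ l.reverse = (colorRow κ l).reverse := by
  simp [colorRow, List.filterMap_reverse]

theorem colorRow_sublist {l l' : List (ColorCell ι r t)} (h : l.Sublist l') :
    (colorRow κ l).Sublist (colorRow κ l') := h.filterMap _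

theorem colorRow_eq_nil {l : List (ColorCell ι r t)} (h : ∀ x ∈ l, x κ = none) :
    colorRow κ l = [] := by
  simpa [colorRow] using h

end ColorRow

namespace Shadow

variable {ι : Type*} {r t : ℕ}

/-- The cell under head `τ`. -/
def head (s : Shadow ι r t) (τ : Fin t) : ColorCell ι r t := (s.zipper τ).2.headD fun _ => none

/-- The cell that is written in the next step. -/
def view (s : Shadow ι r t) : ColorCell ι r t := fun κ =>
  if h : s.phase < r then
    (κ ⟨s.phase, h⟩).elim none fun τ => s.head τ (Function.update κ ⟨s.phase, h⟩ none)
  else none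

/-- A step in which the heads turn and move as told by `g`. -/
def next (s : Shadow ι r t) (g : Fin t → Bool × Bool) : Shadow ι r t where
  zipper τ := (s.zipper τ).write s.view (g τ)
  phase := if ∃ τ, (g τ).1 = true then s.phase + 1 else s.phase
  hist := s.view :: s.hist

/-- In each list, and among all cells written so far, the entries of each color are sorted. -/
structure Ordered [Preorder ι] (s : Shadow ι r t) : Prop where
  -- Cells ahead of a head stem from before the current phase.
  ahead_none : ∀ τ, ∀ x ∈ (s.zipper τ).2, ∀ (κ : Color r t) (q : Fin r),
    s.phase ≤ q → κ q ≠ none → x κ = none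
  behind_none : ∀ τ, ∀ x ∈ (s.zipper τ).1, ∀ (κ : Color r t) (q : Fin r),
    s.phase < q → κ q ≠ none → x κ = none
  hist_none : ∀ x ∈ s.hist, ∀ (κ : Color r t) (q : Fin r),
    s.phase < q → κ q ≠ none → x κ = none
  list_sorted : ∀ τ κ, WeaklySorted (colorRow κ ((s.zipper τ).1.reverse ++ (s.zipper τ).2))
  hist_sorted : ∀ κ, WeaklySorted (colorRow κ s.hist.reverse)
  -- Head τ reads in one direction during the phase: what was copied from it so far, followed by
  -- what is still ahead, is one row of its list.
  phase_sorted : ∀ (q : Fin r), (q : ℕ) = s.phase → ∀ (κ : Color r t) (τ : Fin t),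
    κ q = some τ → WeaklySorted
      (colorRow κ s.hist.reverse ++ colorRow (Function.update κ q none) (s.zipper τ).2)
  -- No head has turned in this phase, so all cells written in it lie untouched behind every head.
  phase_row : ∀ (q : Fin r), (q : ℕ) = s.phase → ∀ (κ : Color r t) (τ : Fin t),
    κ q ≠ none → colorRow κ (s.zipper τ).1 = colorRow κ s.hist

theorem head_toList_sublist (s : Shadow ι r t) (τ : Fin t) (κ : Color r t) :
    (s.head τ κ).toList.Sublist (colorRow κ (s.zipper τ).2) := by
  unfold head
  rcases (s.zipper τ).2 with _ | ⟨x, l⟩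
  · simp
  · simp [colorRow_cons]

theorem view_of_eq_none {s : Shadow ι r t} {κ : Color r t} {q : Fin r} (hq : (q : ℕ) = s.phase)
    (hκ : κ q = none) : s.view κ = none := by
  have h : s.phase < r := hq ▸ q.2
  obtain rfl : q = ⟨s.phase, h⟩ := Fin.ext hq
  simp [view, h, hκ]

theorem view_of_eq_some {s : Shadow ι r t} {κ : Color r t} {q : Fin r} (hq : (q : ℕ) = s.phase)
    {τ : Fin t} (hκ : κ q = some τ) : s.view κ = s.head τ (Function.update κ q none) := by
  have h : s.phase < r := hq ▸ q.2
  obtain rfl : q = ⟨s.phase, h⟩ := Fin.ext hq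
  simp [view, h, hκ]

namespace Ordered

variable [Preorder ι] {s : Shadow ι r t}

theorem head_none (hs : s.Ordered) (τ : Fin t) {κ : Color r t} {q : Fin r} (hq : s.phase ≤ q)
    (hκ : κ q ≠ none) : s.head τ κ = none := by
  have := hs.ahead_none τ
  unfold head
  rcases h : (s.zipper τ).2 with _ | ⟨x, l⟩
  · rfl
  · exact this x (by simp [h]) κ q hq hκ

theorem view_none (hs : s.Ordered) {κ : Color r t} {q : Fin r} (hq : s.phase < q)
    (hκ : κ q ≠ none) : s.view κ = none := by
  unfold view
  split_ifs with h
  · rcases hp : κ ⟨s.phase, h⟩ with _ | τ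
    · rfl
    · refine hs.head_none τ hq.le (q := q) ?_
      rwa [Function.update_of_ne]
      rintro rfl
      simp at hq
  · rfl

/-- Nothing under a head is lost in writing: the entry is recolored with τ in the current phase, a
slot that is still free because its cell predates the phase. -/
theorem exists_view_eq (hs : s.Ordered) (hr : s.phase < r) {τ : Fin t} {κ : Color r t} {i : ι}
    (h : s.head τ κ = some i) : ∃ κ', s.view κ' = some i := by
  refine ⟨Function.update κ ⟨s.phase, hr⟩ (some τ), ?_⟩
  rw [view_of_eq_some (q := ⟨s.phase, hr⟩) rfl (Function.update_self ..),
    Function.update_idem]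
  convert h
  by_contra hne
  have hκ : κ ⟨s.phase, hr⟩ ≠ none := fun h0 => hne (by rw [← h0, Function.update_eq_self])
  simp [hs.head_none τ (q := ⟨s.phase, hr⟩) le_rfl hκ] at h

theorem hist_view_sorted (hs : s.Ordered) (hr : s.phase < r) (κ : Color r t) :
    WeaklySorted (colorRow κ (s.view :: s.hist).reverse) := by
  rw [List.reverse_cons, colorRow_append, colorRow_cons]
  rcases hκ : κ ⟨s.phase, hr⟩ with _ | τ
  · rw [view_of_eq_none rfl hκ]
    simpa [colorRow] using hs.hist_sorted κ
  · rw [view_of_eq_some rfl hκ]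
    refine (hs.phase_sorted ⟨s.phase, hr⟩ rfl κ τ hκ).sublist ?_
    refine (List.Sublist.refl _).append ?_
    simpa [colorRow] using s.head_toList_sublist τ _

/-- If κ does not mark the current phase, the written cell has no entry of color κ. If it does,
nothing ahead has this color and the row behind is the row of the history. -/
theorem list_view_sorted (hs : s.Ordered) (hr : s.phase < r) (τ : Fin t) (κ : Color r t)
    {l : List (ColorCell ι r t)} (hl : l.Sublist (s.zipper τ).2) :
    WeaklySorted (colorRow κ ((s.zipper τ).1.reverse ++ s.view :: l)) := by
  rcases hκ : κ ⟨s.phase, hr⟩ with _ | τ'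
  · rw [colorRow_append, colorRow_cons, view_of_eq_none rfl hκ, Option.toList_none,
      List.nil_append, ← colorRow_append]
    exact (hs.list_sorted τ κ).sublist (colorRow_sublist ((List.Sublist.refl _).append hl))
  · have h0 : κ ⟨s.phase, hr⟩ ≠ none := by simp [hκ]
    have h1 : colorRow κ l = [] :=
      colorRow_eq_nil fun x hx => hs.ahead_none τ x (hl.subset hx) κ ⟨s.phase, hr⟩ le_rfl h0
    rw [colorRow_append, colorRow_cons, h1, colorRow_reverse,
      hs.phase_row ⟨s.phase, hr⟩ rfl κ τ h0, ← colorRow_reverse, List.append_nil]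
    have := hs.hist_view_sorted hr κ
    rwa [List.reverse_cons, colorRow_append, colorRow_cons, colorRow_eq_nil (l := []) (by simp),
      List.append_nil] at this

theorem next_list_sorted (hs : s.Ordered) (hr : s.phase < r) (g : Fin t → Bool × Bool)
    (τ : Fin t) (κ : Color r t) : WeaklySorted
      (colorRow κ (((s.next g).zipper τ).1.reverse ++ ((s.next g).zipper τ).2)) := by
  have h1 := hs.list_view_sorted hr τ κ (List.tail_sublist _)
  have h2 := hs.list_view_sorted hr τ κ (List.Sublist.refl _)
  simp only [next]
  rcases g τ with ⟨_ | _, _ | _⟩ <;> simp only [Zipper.write]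
  · simpa using h2
  · simpa using h1
  · have := h2.reverse
    rw [← colorRow_reverse] at this
    simpa using this
  · have := h1.reverse
    rw [← colorRow_reverse] at this
    simpa using this

/-- A turn opens a phase whose colors are unused, so `phase_sorted` only concerns the part ahead in
a sorted list. Without a turn, the entry under head τ joins the history, and it is duplicated if the
head stays. -/
theorem next (hs : s.Ordered) (hr : s.phase < r) (g : Fin t → Bool × Bool) :
    (s.next g).Ordered := by
  have hcell : ∀ τ x, Zipper.Mem x ((s.next g).zipper τ) → ∀ (κ : Color r t) (q : Fin r),
      s.phase < q → κ q ≠ none → x κ = none := by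
    intro τ x hx κ q hq hκ
    rcases Zipper.mem_write hx with rfl | hx | hx
    · exact hs.view_none hq hκ
    · exact hs.behind_none τ x hx κ q hq hκ
    · exact hs.ahead_none τ x hx κ q hq.le hκ
  have hhist : ∀ x ∈ (s.next g).hist, ∀ (κ : Color r t) (q : Fin r),
      s.phase < q → κ q ≠ none → x κ = none := by
    intro x hx κ q hq hκ
    rcases List.mem_cons.1 hx with rfl | hx
    · exact hs.view_none hq hκ
    · exact hs.hist_none x hx κ q hq hκ
  by_cases hg : ∃ τ, (g τ).1 = true
  · have hp : (s.next g).phase = s.phase + 1 := if_pos hg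
    refine ⟨fun τ x hx κ q hq => hcell τ x (Or.inr hx) κ q (by omega),
      fun τ x hx κ q hq => hcell τ x (Or.inl hx) κ q (by omega),
      fun x hx κ q hq => hhist x hx κ q (by omega), hs.next_list_sorted hr g,
      hs.hist_view_sorted hr, ?_, ?_⟩
    · intro q hq κ τ hκ
      rw [colorRow_reverse, colorRow_eq_nil fun x hx => hhist x hx κ q (by omega) (by simp [hκ])]
      refine (hs.next_list_sorted hr g τ (Function.update κ q none)).sublist ?_
      rw [colorRow_append]
      simp
    · intro q hq κ τ hκ
      rw [colorRow_eq_nil fun x hx => hhist x hx κ q (by omega) hκ,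
        colorRow_eq_nil fun x hx => hcell τ x (Or.inl hx) κ q (by omega) hκ]
  · have hp : (s.next g).phase = s.phase := if_neg hg
    have hgf : ∀ τ, (g τ).1 = false := by simpa using hg
    have hB : ∀ τ, ((s.next g).zipper τ).1 = s.view :: (s.zipper τ).1 := by
      intro τ
      have := hgf τ
      simp only [Shadow.next]
      rcases h : g τ with ⟨_ | _, _ | _⟩ <;> simp_all [Zipper.write]
    have hF : ∀ τ, ((s.next g).zipper τ).2 = (s.zipper τ).2 ∨
        ((s.next g).zipper τ).2 = (s.zipper τ).2.tail := by
      intro τ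
      have := hgf τ
      simp only [Shadow.next]
      rcases h : g τ with ⟨_ | _, _ | _⟩ <;> simp_all [Zipper.write]
    refine ⟨fun τ x hx κ q hq => hs.ahead_none τ x ?_ κ q (by omega),
      fun τ x hx κ q hq => hcell τ x (Or.inl hx) κ q (by omega),
      fun x hx κ q hq => hhist x hx κ q (by omega), hs.next_list_sorted hr g,
      hs.hist_view_sorted hr, ?_, ?_⟩
    · rcases hF τ with h | h <;> rw [h] at hx
      · exact hx
      · exact List.mem_of_mem_tail hx
    · intro q hq κ τ hκ
      have hq' : (q : ℕ) = s.phase := by omega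
      have old := hs.phase_sorted q hq' κ τ hκ
      have e : colorRow κ (s.next g).hist.reverse = colorRow κ s.hist.reverse ++
          (s.head τ (Function.update κ q none)).toList := by
        simp only [Shadow.next, List.reverse_cons, colorRow_append, colorRow_cons,
          view_of_eq_some hq' hκ]
        simp [colorRow]
      rw [e]
      unfold head
      rcases hl : (s.zipper τ).2 with _ | ⟨x, l⟩
      · rw [hl] at old
        rcases hF τ with h | h <;> simpa [h, hl] using old
      · rw [hl, colorRow_cons] at old
        rcases hF τ with h | h <;> rw [h, hl]
        · rw [colorRow_cons]
          rcases hx : x (Function.update κ q none) with _ | i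
          · simpa [hx] using old
          · simpa [hx] using WeaklySorted.duplicate (by simpa [hx] using old)
        · simpa using old
    · intro q hq κ τ hκ
      have hq' : (q : ℕ) = s.phase := by omega
      rw [hB]
      simp only [Shadow.next, colorRow_cons, hs.phase_row q hq' κ τ hκ]

end Ordered

/-- The shadow of an initial configuration with `m` inputs on the first list. -/
def init (m r t : ℕ) : Shadow (Fin m) r t where
  zipper τ := ([], if (τ : ℕ) = 0 then
      List.ofFn fun i κ => if κ = fun _ => none then some i else none
    else [fun _ => none])
  phase := 0
  hist := []

theorem ordered_init (m r t : ℕ) : (init m r t).Ordered := by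
  have h0 : ∀ τ, ∀ x ∈ ((init m r t).zipper τ).2, ∀ (κ : Color r t) (q : Fin r),
      κ q ≠ none → x κ = none := by
    intro τ x hx κ q hκ
    simp only [init] at hx
    split_ifs at hx
    · obtain ⟨i, rfl⟩ := List.mem_ofFn.1 hx
      simp only [ite_eq_right_iff]
      rintro rfl
      simp at hκ
    · rw [List.mem_singleton.1 hx]
  have h1 : ∀ τ κ, WeaklySorted (colorRow κ ((init m r t).zipper τ).2) := by
    intro τ κ
    left
    simp only [init]
    split_ifs
    · by_cases hκ : κ = fun _ => none
      · have : ∀ l : List (Fin m), colorRow κ (l.map fun i (κ : Color r t) =>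
            if κ = fun _ => none then some i else none) = l := by
          intro l
          simp [colorRow, hκ, List.filterMap_map]
        rw [List.ofFn_eq_map, this]
        exact (List.pairwise_lt_finRange m).imp le_of_lt
      · rw [colorRow_eq_nil]
        · simp
        · intro x hx
          obtain ⟨i, rfl⟩ := List.mem_ofFn.1 hx
          simp [hκ]
    · simp [colorRow]
  refine ⟨fun τ x hx κ q _ => h0 τ x hx κ q, by simp [init], by simp [init], ?_,
    by simp [init, colorRow, WeaklySorted], ?_, by simp [init]⟩
  · intro τ κ
    simpa [init] using h1 τ κ
  · intro q _ κ τ _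
    simpa [init, colorRow] using h1 τ (Function.update κ q none)

end Shadow

/-! ### Pairs of input positions that share a cell -/

theorem card_le_sortedness {m : ℕ} (φ : Equiv.Perm (Fin m)) (S : Finset (Fin m))
    (h : (∀ i ∈ S, ∀ j ∈ S, i < j → φ i < φ j) ∨ ∀ i ∈ S, ∀ j ∈ S, i < j → φ j < φ i) :
    S.card ≤ sortedness φ := by
  refine le_csSup (sortedness_bddAbove φ) ⟨S.orderEmbOfFin rfl, (S.orderEmbOfFin rfl).strictMono,
    h.imp ?_ ?_⟩ <;>
  · intro h i j hij
    exact h _ (S.orderEmbOfFin_mem rfl i) _ (S.orderEmbOfFin_mem rfl j)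
      ((S.orderEmbOfFin rfl).strictMono hij)

theorem WeaklySorted.getElem {α ι : Type*} [Preorder ι] {f : α → Option ι} {l : List α}
    (h : WeaklySorted (l.filterMap f)) :
    (∀ (p q : ℕ) (x y : α) (i j : ι), p < q → l[p]? = some x → l[q]? = some y → f x = some i →
      f y = some j → i ≤ j) ∨
    ∀ (p q : ℕ) (x y : α) (i j : ι), p < q → l[p]? = some x → l[q]? = some y → f x = some i →
      f y = some j → j ≤ i := by
  refine h.imp ?_ ?_ <;>
  · intro h p q x y i j hpq hx hy hi hj
    rw [List.pairwise_filterMap, List.pairwise_iff_getElem] at h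
    obtain ⟨hp, rfl⟩ := List.getElem?_eq_some_iff.1 hx
    obtain ⟨hq, rfl⟩ := List.getElem?_eq_some_iff.1 hy
    exact h p q hp hq hpq i hi j hj

/-- If the entries of each color are sorted, then for at most `c ^ 2 * sortedness φ` indices `i`,
where `c` is the number of colors, there is a cell that contains both `a i` and `b (φ i)`. -/
theorem card_common_cell_le {ι K : Type*} [LinearOrder ι] [Fintype K] {m : ℕ}
    {l : List (K → Option ι)} (hl : ∀ κ, WeaklySorted (l.filterMap fun x => x κ))
    (φ : Equiv.Perm (Fin m)) {a b : Fin m → ι} (ha : StrictMono a) (hb : StrictMono b)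
    (S : Finset (Fin m))
    (hS : ∀ i ∈ S, ∃ x ∈ l, (∃ κ, x κ = some (a i)) ∧ ∃ κ, x κ = some (b (φ i))) :
    S.card ≤ Fintype.card K ^ 2 * sortedness φ := by
  classical
  let T : K × K → Finset (Fin m) := fun κ => S.filter fun i =>
    ∃ x ∈ l, x κ.1 = some (a i) ∧ x κ.2 = some (b (φ i))
  have hST : S ⊆ Finset.univ.biUnion T := by
    intro i hi
    obtain ⟨x, hx, ⟨κ, h⟩, κ', h'⟩ := hS i hi
    exact Finset.mem_biUnion.2 ⟨(κ, κ'), Finset.mem_univ _,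
      Finset.mem_filter.2 ⟨hi, x, hx, h, h'⟩⟩
  have hT : ∀ κ ∈ (Finset.univ : Finset (K × K)), (T κ).card ≤ sortedness φ := by
    rintro ⟨κ, κ'⟩ -
    have hmem : ∀ i ∈ T (κ, κ'), ∃ (p : ℕ) (x : K → Option ι), l[p]? = some x ∧
        x κ = some (a i) ∧ x κ' = some (b (φ i)) := by
      intro i hi
      obtain ⟨x, hx, h⟩ := (Finset.mem_filter.1 hi).2
      obtain ⟨p, hp⟩ := List.mem_iff_getElem?.1 hx
      exact ⟨p, x, hp, h⟩
    have hφ : ∀ {i j}, i < j → φ i ≠ φ j := fun hij h => hij.ne (φ.injective h)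
    apply card_le_sortedness
    -- If the two rows are sorted in the same direction, φ increases on this set; otherwise it
    -- decreases.
    rcases (hl κ).getElem with h1 | h1 <;> rcases (hl κ').getElem with h2 | h2 <;>
      [left; right; right; left] <;> intro i hi j hj hij <;>
      obtain ⟨p, x, hp, hx, hx'⟩ := hmem i hi <;> obtain ⟨q, y, hq, hy, hy'⟩ := hmem j hj <;>
      have hpq : p ≠ q := by
        rintro rfl
        obtain rfl : x = y := Option.some_injective _ (hp.symm.trans hq)
        exact hij.ne (ha.injective (Option.some_injective _ (hx.symm.trans hy)))
    all_goals rcases hpq.lt_or_gt with h | h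
    all_goals
      have e1 := h1 _ _ _ _ _ _ h (by assumption) (by assumption) (by assumption) (by assumption)
      have e2 := h2 _ _ _ _ _ _ h (by assumption) (by assumption) (by assumption) (by assumption)
      rw [ha.le_iff_le] at e1
      rw [hb.le_iff_le] at e2
      first
      | exact absurd e1 hij.not_ge
      | exact lt_of_le_of_ne e2 (hφ hij)
      | exact lt_of_le_of_ne e2 (hφ hij).symm
  calc S.card ≤ (Finset.univ.biUnion T).card := Finset.card_le_card hST
    _ ≤ (Finset.univ : Finset (K × K)).card * sortedness φ := Finset.card_biUnion_le_card_mul _ _ _ hT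
    _ = _ := by rw [Finset.card_univ, Fintype.card_prod, sq]

/-! ### The number of phases and of writing steps -/

namespace Zipper

variable {α : Type*}

theorem length_write {y : α} {g : Bool × Bool} {z : Zipper α} (hz : z.2 ≠ []) :
    (z.write y g).1.length + (z.write y g).2.length =
      z.1.length + z.2.length + if g.2 = true then 0 else 1 := by
  have : 0 < z.2.length := List.length_pos_iff.2 hz
  rcases g with ⟨_ | _, _ | _⟩ <;> simp [write] <;> omega

theorem length_snd_write {y : α} {g : Bool × Bool} {z : Zipper α} (hz : z.2 ≠ [])
    (hg : g.1 = false) :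
    (z.write y g).2.length + (if g.2 = true then 1 else 0) = z.2.length := by
  have : 0 < z.2.length := List.length_pos_iff.2 hz
  rcases g with ⟨_ | _, _ | _⟩ <;> simp_all [write]
  omega

end Zipper

/-- The flow of input positions in the first `j` steps with signatures `σ 0, σ 1, …`. -/
def shadowRun {A : Type*} {t : ℕ} (m r : ℕ) (σ : ℕ → Option (A × (Fin t → Bool × Bool))) :
    ℕ → Shadow (Fin m) r t
  | 0 => Shadow.init m r t
  | j + 1 => (σ j).elim (shadowRun m r σ j) fun x => (shadowRun m r σ j).next x.2

section ShadowRun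

variable {A : Type*} {t m r : ℕ} {σ : ℕ → Option (A × (Fin t → Bool × Bool))}

theorem shadowRun_succ_of_none {j : ℕ} (h : σ j = none) :
    shadowRun m r σ (j + 1) = shadowRun m r σ j := by simp [shadowRun, h]

theorem shadowRun_succ_of_some {j : ℕ} {a : A} {g : Fin t → Bool × Bool}
    (h : σ j = some (a, g)) :
    shadowRun m r σ (j + 1) = (shadowRun m r σ j).next g := by simp [shadowRun, h]

theorem shadowRun_hist_suffix {i j : ℕ} (hij : i ≤ j) :
    (shadowRun m r σ i).hist <:+ (shadowRun m r σ j).hist := by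
  induction j, hij using Nat.le_induction with
  | base => exact List.suffix_refl _
  | succ j _ ih =>
    rcases h : σ j with _ | ⟨a, g⟩
    · rwa [shadowRun_succ_of_none h]
    · rw [shadowRun_succ_of_some h]
      exact ih.trans (List.suffix_cons _ _)

theorem shadowRun_phase_mono {i j : ℕ} (hij : i ≤ j) :
    (shadowRun m r σ i).phase ≤ (shadowRun m r σ j).phase := by
  induction j, hij using Nat.le_induction with
  | base => exact le_rfl
  | succ j _ ih =>
    rcases h : σ j with _ | ⟨a, g⟩
    · rwa [shadowRun_succ_of_none h]
    · rw [shadowRun_succ_of_some h]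
      simp only [Shadow.next]
      split_ifs <;> omega

theorem shadowRun_eq_of_none {i j : ℕ} (hij : i ≤ j) (h : ∀ l, i ≤ l → l < j → σ l = none) :
    shadowRun m r σ j = shadowRun m r σ i := by
  induction j, hij using Nat.le_induction with
  | base => rfl
  | succ j hj ih =>
    rw [shadowRun_succ_of_none (h j hj j.lt_succ_self), ih fun l h1 h2 => h l h1 (by omega)]

theorem signature_eq_none_of_hist_length_eq {i j : ℕ}
    (h : (shadowRun m r σ i).hist.length = (shadowRun m r σ j).hist.length) {l : ℕ}
    (hi : i ≤ l) (hj : l < j) : σ l = none := by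
  rcases hl : σ l with _ | ⟨a, g⟩
  · rfl
  · have h1 := (shadowRun_hist_suffix (m := m) (r := r) (σ := σ) hi).length_le
    have h2 := (shadowRun_hist_suffix (m := m) (r := r) (σ := σ) (i := l + 1) hj).length_le
    rw [shadowRun_succ_of_some hl] at h2
    simp only [Shadow.next, List.length_cons] at h2
    omega

theorem shadowRun_congr {σ' : ℕ → Option (A × (Fin t → Bool × Bool))} {j : ℕ}
    (h : ∀ i < j, σ i = σ' i) : shadowRun m r σ j = shadowRun m r σ' j := by
  induction j with
  | zero => rfl
  | succ j ih =>
    simp only [shadowRun, ih fun i hi => h i (by omega), h j j.lt_succ_self]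

theorem ordered_shadowRun (h : ∀ j, (shadowRun m r σ j).phase < r) (j : ℕ) :
    (shadowRun m r σ j).Ordered := by
  induction j with
  | zero => exact Shadow.ordered_init m r t
  | succ j ih =>
    rcases hj : σ j with _ | ⟨a, g⟩
    · rwa [shadowRun_succ_of_none hj]
    · rw [shadowRun_succ_of_some hj]
      exact ih.next (h j) g

end ShadowRun

theorem LMConfig.rev_range {t : ℕ} {I C A : Type*} (f : ℕ → LMConfig t I C A) (T : ℕ)
    (τ : Fin t) : LMConfig.rev ((List.range (T + 1)).map f) τ =
      ((Finset.range T).filter fun j => (f j).dir τ ≠ (f (j + 1)).dir τ).card := by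
  induction T generalizing f with
  | zero => simp [LMConfig.rev]
  | succ T ih =>
    have := ih fun j => f (j + 1)
    rw [Finset.card_filter, Finset.sum_range_succ', ← Finset.card_filter, ← this,
      List.range_succ_eq_map, List.range_succ_eq_map]
    simp only [LMConfig.rev, List.map_cons, List.tail_cons, List.zip_cons_cons, List.countP_cons,
      List.map_map, decide_eq_true_eq]
    simp [Function.comp_def]

namespace NLM

variable {t m : ℕ} {I C A : Type*} {M : NLM t m I C A} {c : ℕ → C} {γ : LMConfig t I C A}

/-- The signatures of the steps of a trajectory. -/
noncomputable def signatures (M : NLM t m I C A) (c : ℕ → C) (γ : LMConfig t I C A) (j : ℕ) :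
    Option (A × (Fin t → Bool × Bool)) := M.signature (c j) (M.traj c γ j)

theorem signature_of_final {x : C} (h : γ.state ∈ M.final) : M.signature x γ = none := by
  simp [signature, h]

/-- Only an inequality, since several heads may turn in one step while the phase advances by one. -/
theorem phase_le_sum_rev (hγ : γ.WellFormed) (r j : ℕ) :
    (shadowRun m r (M.signatures c γ) j).phase ≤
      ∑ τ, LMConfig.rev ((List.range (j + 1)).map (M.traj c γ)) τ := by
  simp only [LMConfig.rev_range]
  induction j with
  | zero => simp [shadowRun, Shadow.init]
  | succ j ih =>
    simp only [Finset.card_filter, Finset.sum_range_succ, Finset.sum_add_distrib] at ih ⊢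
    rcases h : M.signatures c γ j with _ | ⟨a, g⟩
    · rw [shadowRun_succ_of_none h]
      omega
    · rw [shadowRun_succ_of_some h]
      simp only [Shadow.next]
      split_ifs with hg
      · obtain ⟨τ, hτ⟩ := hg
        refine add_le_add ih ?_
        have := ((step_of_signature_eq_some (wellFormed_traj hγ j) h).2.2.2.2 τ).2.2 hτ
        refine le_trans ?_ (Finset.single_le_sum (fun _ _ => Nat.zero_le _) (Finset.mem_univ τ))
        rw [if_pos]
        exact this.symm
      · omega

/-- Bounds the number of steps that change the lists before the next change of a direction. -/
def potential (γ : LMConfig t I C A) : ℕ :=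
  ∑ τ, ((γ.zipper τ).1.length + (γ.zipper τ).2.length + t * (γ.zipper τ).2.length)

/-- Without a turn some head moves and loses the weight t, while each of the other t-1 lists gains
at most 1: a net loss of at least 1. A turn may bring all cells of a list ahead, which costs a
factor t+1; since 2 ≤ t this also absorbs the new cell. -/
theorem potential_step (ht : 2 ≤ t) {x : C} (hγ : γ.WellFormed) {a : A}
    {g : Fin t → Bool × Bool} (h : M.signature x γ = some (a, g)) :
    1 + potential (M.step x γ) ≤ (if ∃ τ, (g τ).1 = true then t + 1 else 1) * potential γ := by
  obtain ⟨-, -, ⟨τ₀, h₀⟩, -, h⟩ := step_of_signature_eq_some hγ h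
  have hl := fun τ => Zipper.length_write (y := γ.written x) (g := g τ) (hγ.ahead_ne_nil τ)
  have hpos := fun τ => List.length_pos_iff.2 (hγ.ahead_ne_nil τ)
  have hcard : ∑ _τ : Fin t, 1 = t := by simp
  unfold potential
  simp only [fun τ => (h τ).1]
  split_ifs with hg
  · rw [Finset.mul_sum]
    refine le_trans (b := ∑ τ : Fin t, (1 + (((γ.zipper τ).write (γ.written x) (g τ)).1.length +
      ((γ.zipper τ).write (γ.written x) (g τ)).2.length +
        t * ((γ.zipper τ).write (γ.written x) (g τ)).2.length))) ?_ ?_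
    · rw [Finset.sum_add_distrib (f := fun _ => 1), hcard]
      omega
    · refine Finset.sum_le_sum fun τ _ => ?_
      have h1 : ((γ.zipper τ).write (γ.written x) (g τ)).1.length +
          ((γ.zipper τ).write (γ.written x) (g τ)).2.length ≤
          (γ.zipper τ).1.length + (γ.zipper τ).2.length + 1 := by
        rw [hl]; split_ifs <;> omega
      have h2 := hpos τ
      generalize ((γ.zipper τ).write (γ.written x) (g τ)).1.length = b' at *
      generalize ((γ.zipper τ).write (γ.written x) (g τ)).2.length = f' at *
      generalize (γ.zipper τ).1.length = b at *
      generalize (γ.zipper τ).2.length = f at *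
      nlinarith [Nat.mul_le_mul_left t h1, Nat.mul_le_mul_left (t * t) h2]
  · have hgf : ∀ τ, (g τ).1 = false := by simpa using hg
    have hs := fun τ => Zipper.length_snd_write (y := γ.written x) (hγ.ahead_ne_nil τ) (hgf τ)
    have h0 : (g τ₀).2 = true := by
      by_contra h'
      exact h₀ (Prod.ext (hgf τ₀) (by simpa using h'))
    have key : ∀ τ, (((γ.zipper τ).write (γ.written x) (g τ)).1.length +
      ((γ.zipper τ).write (γ.written x) (g τ)).2.length +
        t * ((γ.zipper τ).write (γ.written x) (g τ)).2.length) + (if τ = τ₀ then t + 1 else 0) ≤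
        ((γ.zipper τ).1.length + (γ.zipper τ).2.length + t * (γ.zipper τ).2.length) + 1 := by
      intro τ
      rw [hl, ← hs]
      rcases eq_or_ne τ τ₀ with rfl | hne
      · simp [h0, mul_add]
        omega
      · rw [if_neg hne]
        split_ifs <;> simp [mul_add] <;> omega
    have := Finset.sum_le_sum fun τ (_ : τ ∈ Finset.univ) => key τ
    rw [Finset.sum_add_distrib, Finset.sum_add_distrib (g := fun _ => 1), hcard,
      Finset.sum_ite_eq' Finset.univ τ₀, if_pos (Finset.mem_univ _)] at this
    omega

theorem hist_length_add_potential_le (ht : 2 ≤ t) (hγ : γ.WellFormed) (r j : ℕ) :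
    (shadowRun m r (M.signatures c γ) j).hist.length + potential (M.traj c γ j) ≤
      (t + 1) ^ (shadowRun m r (M.signatures c γ) j).phase * potential γ := by
  induction j with
  | zero => simp [shadowRun, Shadow.init, traj]
  | succ j ih =>
    rcases h : M.signatures c γ j with _ | ⟨a, g⟩
    · rw [shadowRun_succ_of_none h]
      have : potential (M.traj c γ (j + 1)) = potential (M.traj c γ j) := by
        simp only [potential, traj, zipper_step_of_signature_eq_none h]
      rwa [this]
    · rw [shadowRun_succ_of_some h]
      have := potential_step ht (wellFormed_traj hγ j) h
      simp only [Shadow.next, List.length_cons, traj]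
      split_ifs at this ⊢ with hg
      · rw [pow_succ]
        nlinarith
      · omega

theorem potential_init (M : NLM t m I C A) (v : Fin m → I) :
    potential (M.init v) ≤ (t + 1) * (m + t) := by
  have : ∀ τ : Fin t, ((M.init v).zipper τ).1.length + ((M.init v).zipper τ).2.length +
      t * ((M.init v).zipper τ).2.length ≤ (t + 1) * ((if (τ : ℕ) = 0 then m else 0) + 1) := by
    intro τ
    rw [zipper_init]
    split_ifs <;> simp <;> nlinarith
  refine (Finset.sum_le_sum fun τ _ => this τ).trans ?_
  rw [← Finset.mul_sum, Finset.sum_add_distrib]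
  refine Nat.mul_le_mul_left _ (add_le_add ?_ (by simp))
  rcases t with _ | t
  · simp
  · rw [Fin.sum_univ_succ]
    simp

end NLM

/-! ### Loops and the running time -/

namespace NLM

variable {t m : ℕ} {I C A : Type*} {M : NLM t m I C A} {c : ℕ → C}

theorem traj_eq_of_signatures_eq_none {γ : LMConfig t I C A} {i j : ℕ} (hij : i ≤ j)
    (h : ∀ l, i ≤ l → l < j → M.signatures c γ l = none) :
    M.traj c γ j = { M.traj c γ i with state := (M.traj c γ j).state } := by
  induction j, hij using Nat.le_induction with
  | base => rfl
  | succ j hj ih =>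
    have h1 := step_of_signature_eq_none (h j hj j.lt_succ_self)
    have h2 := ih fun l h1 h2 => h l h1 (by omega)
    rw [traj, h1, h2]

theorem isSucc_traj {γ : LMConfig t I C A} {j : ℕ} (h : (M.traj c γ j).state ∉ M.final) :
    M.IsSucc (c j) (M.traj c γ j) (M.traj c γ (j + 1)) := isSucc_iff.2 ⟨h, rfl⟩

theorem exists_isInfiniteRun_of_traj_eq {v : Fin m → I} {i j : ℕ} (hij : i < j)
    (h : M.traj c (M.init v) i = M.traj c (M.init v) j)
    (hf : ∀ l < j, (M.traj c (M.init v) l).state ∉ M.final) : ∃ ρ, M.IsInfiniteRun v ρ := by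
  -- The walk through the times returns to i instead of reaching j.
  let next : ℕ → ℕ := fun l => if l + 1 = j then i else l + 1
  have hnext : ∀ n, next^[n] 0 < j := by
    intro n
    induction n with
    | zero => exact (Nat.zero_le i).trans_lt hij
    | succ n ih =>
      rw [Function.iterate_succ_apply']
      change (if next^[n] 0 + 1 = j then i else next^[n] 0 + 1) < j
      split_ifs <;> omega
  refine ⟨fun n => M.traj c (M.init v) (next^[n] 0), rfl, fun n => ⟨c (next^[n] 0), ?_⟩⟩
  simp only [Function.iterate_succ_apply']
  convert isSucc_traj (hf _ (hnext n)) using 1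
  simp only [next]
  split_ifs with h'
  · rw [h, h']
  · rfl

theorem isRun_of_final {v : Fin m → I} {T : ℕ} (hT : (M.traj c (M.init v) T).state ∈ M.final)
    (h : ∀ l < T, (M.traj c (M.init v) l).state ∉ M.final) :
    M.IsRun v ((List.range (T + 1)).map (M.traj c (M.init v))) := by
  refine ⟨by simp [List.range_succ_eq_map, traj], ?_, _, by simp [List.range_succ], hT⟩
  rw [List.isChain_map, List.isChain_range_succ]
  exact fun l hl => ⟨c l, isSucc_traj (h l hl)⟩

namespace IsBounded

variable {r t' : ℕ}

theorem exists_final (hM : M.IsBounded r t') (c : ℕ → C) (v : Fin m → I) :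
    ∃ T, (M.traj c (M.init v) T).state ∈ M.final ∧
      ∀ l < T, (M.traj c (M.init v) l).state ∉ M.final := by
  classical
  have : ∃ T, (M.traj c (M.init v) T).state ∈ M.final := by
    by_contra! h
    exact hM.2.1 v (M.traj c (M.init v)) ⟨rfl, fun i => ⟨c i, isSucc_traj (h i)⟩⟩
  exact ⟨Nat.find this, Nat.find_spec this, fun l hl => Nat.find_min this hl⟩

theorem phase_lt (hM : M.IsBounded r t') (hm : 0 < m) (c : ℕ → C) (v : Fin m → I) (j : ℕ) :
    (shadowRun m r (M.signatures c (M.init v)) j).phase < r := by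
  obtain ⟨T, hT, hl⟩ := hM.exists_final c v
  have h1 := hM.2.2 v _ (isRun_of_final hT hl)
  have h2 := phase_le_sum_rev (M := M) (c := c) (M.wellFormed_init hm v) r T
  have h3 : (shadowRun m r (M.signatures c (M.init v)) j).phase ≤
      (shadowRun m r (M.signatures c (M.init v)) T).phase := by
    rcases le_total j T with h | h
    · exact shadowRun_phase_mono h
    · rw [shadowRun_eq_of_none h]
      intro l hl _
      exact signature_of_final (by rwa [traj_of_final hT hl])
  omega

theorem hist_length_le (hM : M.IsBounded r t') (hm : 0 < m) (ht : 2 ≤ t) (c : ℕ → C)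
    (v : Fin m → I) (j : ℕ) :
    (shadowRun m r (M.signatures c (M.init v)) j).hist.length ≤ (t + 1) ^ r * (m + t) := by
  have h1 := hist_length_add_potential_le (M := M) (c := c) ht (M.wellFormed_init hm v) r j
  have h2 := hM.phase_lt hm c v j
  calc _ ≤ (t + 1) ^ (shadowRun m r (M.signatures c (M.init v)) j).phase *
        ((t + 1) * (m + t)) :=
        (Nat.le_add_right _ _).trans (h1.trans (Nat.mul_le_mul_left _ (potential_init M v)))
    _ = (t + 1) ^ ((shadowRun m r (M.signatures c (M.init v)) j).phase + 1) * (m + t) := by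
        rw [pow_succ, mul_assoc]
    _ ≤ _ := Nat.mul_le_mul_right _ (Nat.pow_le_pow_right (by omega) h2)

/-- In a stretch without writing, configurations differ only in their states, so a repeated state
closes a loop and yields an infinite run. -/
theorem state_ne (hM : M.IsBounded r t') {v : Fin m → I} {i j : ℕ} (hij : i < j)
    (hf : ∀ l < j, (M.traj c (M.init v) l).state ∉ M.final)
    (h : ∀ l, i ≤ l → l < j → M.signatures c (M.init v) l = none) :
    (M.traj c (M.init v) i).state ≠ (M.traj c (M.init v) j).state := by
  intro heq
  have := traj_eq_of_signatures_eq_none hij.le h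
  rw [← heq] at this
  obtain ⟨ρ, hρ⟩ := exists_isInfiniteRun_of_traj_eq hij this.symm hf
  exact hM.2.1 v ρ hρ

/-- Before the final configuration, the pair of history length and state never repeats; the bound
counts these pairs. -/
theorem final_of_le (hM : M.IsBounded r t') (hm : 0 < m) (ht : 2 ≤ t) [Finite A] (c : ℕ → C)
    (v : Fin m → I) {j : ℕ} (hj : ((t + 1) ^ r * (m + t) + 1) * Nat.card A ≤ j) :
    (M.traj c (M.init v) j).state ∈ M.final := by
  have := Fintype.ofFinite A
  obtain ⟨T, hT, hl⟩ := hM.exists_final c v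
  by_contra hn
  have hjT : j < T := by
    by_contra h
    exact hn (by rwa [traj_of_final hT (not_lt.1 h)])
  let f : ℕ → ℕ × A := fun i =>
    ((shadowRun m r (M.signatures c (M.init v)) i).hist.length, (M.traj c (M.init v) i).state)
  have hinj : Set.InjOn f (Finset.range (j + 1)) := by
    have : ∀ i l, i < l → l ≤ j → f i ≠ f l := by
      intro i l hil hlj h
      rw [Prod.mk.injEq] at h
      exact hM.state_ne hil (fun q hq => hl q (by omega))
        (fun q h1 h2 => signature_eq_none_of_hist_length_eq h.1 h1 h2) h.2
    intro i hi l hlj h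
    rw [Finset.mem_coe, Finset.mem_range] at hi hlj
    rcases lt_trichotomy i l with h' | h' | h'
    · exact absurd h (this i l h' (by omega))
    · exact h'
    · exact absurd h.symm (this l i h' (by omega))
  have := Finset.card_le_card_of_injOn (t := Finset.range ((t + 1) ^ r * (m + t) + 1) ×ˢ
    (Finset.univ : Finset A)) f (fun i _ => by
      simpa [f, Nat.lt_succ_iff] using hM.hist_length_le hm ht c v i) hinj
  rw [Finset.card_product, Finset.card_range, Finset.card_range, Finset.card_univ,
    ← Nat.card_eq_fintype_card] at this
  omega

end IsBounded

end NLM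

/-! ### Encoding sequences by their gaps -/

/-- The entries of `σ s, …, σ (s + n - 1)`, each with the number of positions skipped before
it, when `g` positions were skipped before `s`. -/
def encodeGaps {α : Type*} (σ : ℕ → Option α) : ℕ → ℕ → ℕ → List (ℕ × α)
  | 0, _, _ => []
  | n + 1, s, g => (σ s).elim (encodeGaps σ n (s + 1) (g + 1)) fun x =>
      (g, x) :: encodeGaps σ n (s + 1) 0

section EncodeGaps

variable {α : Type*} {σ σ' : ℕ → Option α}

theorem le_of_encodeGaps_eq_cons {n s g : ℕ} {x : ℕ × α} {l : List (ℕ × α)}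
    (h : encodeGaps σ n s g = x :: l) : g ≤ x.1 := by
  induction n generalizing s g with
  | zero => simp [encodeGaps] at h
  | succ n ih =>
    rcases hs : σ s with _ | a
    · rw [encodeGaps, hs] at h
      exact (Nat.le_succ g).trans (ih h)
    · rw [encodeGaps, hs] at h
      simp only [Option.elim_some, List.cons.injEq] at h
      rw [← h.1]

/-- A skipped entry raises the counter, so the next recorded gap distinguishes `none` from an entry.
Trailing `none`s leave no trace, but the length n is fixed. -/
theorem encodeGaps_injective {n s g : ℕ} (h : encodeGaps σ n s g = encodeGaps σ' n s g) :
    ∀ i < n, σ (s + i) = σ' (s + i) := by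
  induction n generalizing s g with
  | zero => simp
  | succ n ih =>
    suffices σ s = σ' s ∧ ∃ g', encodeGaps σ n (s + 1) g' = encodeGaps σ' n (s + 1) g' by
      obtain ⟨h0, g', h'⟩ := this
      rintro (_ | i) hi
      · exact h0
      · simpa [add_assoc, add_comm 1 i] using ih h' i (by omega)
    rcases hs : σ s with _ | a <;> rcases hs' : σ' s with _ | a' <;>
      simp only [encodeGaps, hs, hs', Option.elim_none, Option.elim_some] at h
    · exact ⟨rfl, _, h⟩
    · have := le_of_encodeGaps_eq_cons h
      simp at this
    · have := le_of_encodeGaps_eq_cons h.symm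
      simp at this
    · simp only [List.cons.injEq, Prod.mk.injEq, true_and] at h
      exact ⟨by rw [h.1], 0, h.2⟩

theorem exists_of_mem_encodeGaps {n s g : ℕ} {x : ℕ × α} (hx : x ∈ encodeGaps σ n s g)
    (hg : g ≤ s) (h0 : ∀ i, s - g ≤ i → i < s → σ i = none) :
    ∃ j, x.1 ≤ j ∧ j < s + n ∧ σ j = some x.2 ∧ ∀ i, j - x.1 ≤ i → i < j → σ i = none := by
  induction n generalizing s g with
  | zero => simp [encodeGaps] at hx
  | succ n ih =>
    rcases hs : σ s with _ | a <;>
      simp only [encodeGaps, hs, Option.elim_none, Option.elim_some, List.mem_cons] at hx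
    · obtain ⟨j, h1, h2, h3⟩ := ih hx (by omega) fun i h1 h2 => by
        rcases eq_or_ne i s with rfl | hne
        · exact hs
        · exact h0 i (by omega) (by omega)
      exact ⟨j, h1, by omega, h3⟩
    · rcases hx with rfl | hx
      · exact ⟨s, hg, by omega, hs, h0⟩
      · obtain ⟨j, h1, h2, h3⟩ := ih hx (by omega) fun i h1 h2 => by omega
        exact ⟨j, h1, by omega, h3⟩

/-- Each recorded entry is a step that writes one cell, so a bound on the history bounds the code.
-/
theorem length_encodeGaps {A : Type*} {t : ℕ} (m r : ℕ)
    (σ : ℕ → Option (A × (Fin t → Bool × Bool))) (n s g : ℕ) :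
    (shadowRun m r σ s).hist.length + (encodeGaps σ n s g).length =
      (shadowRun m r σ (s + n)).hist.length := by
  induction n generalizing s g with
  | zero => simp [encodeGaps]
  | succ n ih =>
    rw [← add_assoc, add_right_comm]
    rcases hs : σ s with _ | ⟨a, b⟩ <;>
      simp only [encodeGaps, hs, Option.elim_none, Option.elim_some, List.length_cons]
    · rw [← ih (s + 1) (g + 1), shadowRun_succ_of_none hs]
    · rw [← ih (s + 1) 0, shadowRun_succ_of_some hs]
      simp only [Shadow.next, List.length_cons]
      omega

end EncodeGaps

/-! ### Inputs that differ in one position -/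

/-- The input position `i` occurs in the cell `x`. -/
def ColorCell.Occurs {ι : Type*} {r t : ℕ} (i : ι) (x : ColorCell ι r t) : Prop :=
  ∃ κ, x κ = some i

namespace NLM

variable {t m r : ℕ} {I C A : Type*} {M : NLM t m I C A}

/-- The configurations `γ` and `γ'` have the same shape, with the flow of input positions
described by `s`, and differ only where the input position `k` occurs. -/
structure AgreeOff (k : Fin m) (s : Shadow (Fin m) r t) (γ γ' : LMConfig t I C A) : Prop where
  dir_eq : γ.dir = γ'.dir
  cells : ∀ τ, ∃ z : Zipper (List (LMSymbol I C A) × List (LMSymbol I C A) ×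
      ColorCell (Fin m) r t),
    γ.zipper τ = z.map (·.1) ∧ γ'.zipper τ = z.map (·.2.1) ∧ s.zipper τ = z.map (·.2.2) ∧
    ∀ x, z.Mem x → ¬ x.2.2.Occurs k → x.1 = x.2.1
  -- A step with signature `none` may change the state depending on the visible cells without
  -- recording it, so nothing is claimed while k is visible.
  state_eq : ¬ s.view.Occurs k → γ.state = γ'.state

namespace AgreeOff

variable {k : Fin m} {s : Shadow (Fin m) r t} {γ γ' : LMConfig t I C A}

theorem step_eq (h : AgreeOff k s γ γ') (hs : s.Ordered) (hr : s.phase < r)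
    (hγ : γ.WellFormed) (hγ' : γ'.WellFormed) (hk : ¬ s.view.Occurs k) (c : C) :
    M.signature c γ = M.signature c γ' ∧ (M.step c γ).state = (M.step c γ').state ∧
      γ.written c = γ'.written c := by
  refine step_congr M c hγ hγ' (h.state_eq hk) h.dir_eq ?_ ?_ ?_ <;> intro τ <;>
    obtain ⟨z, h1, h2, h3, h4⟩ := h.cells τ <;> rw [h1, h2]
  · rcases hz : z.2 with _ | ⟨x, l⟩
    · simp [Zipper.map, hz]
    · simp only [Zipper.map, hz, List.map_cons, List.headD_cons]
      refine h4 x (Or.inr (by simp [hz])) fun ⟨κ, hκ⟩ => hk (hs.exists_view_eq hr (τ := τ) (κ := κ) ?_)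
      simpa [Shadow.head, h3, Zipper.map, hz] using hκ
  · simp [Zipper.map]
  · simp [Zipper.map]

theorem step_none (h : AgreeOff k s γ γ') {c : C} (h1 : M.signature c γ = none)
    (h2 : M.signature c γ' = none)
    (hst : ¬ s.view.Occurs k → (M.step c γ).state = (M.step c γ').state) :
    AgreeOff k s (M.step c γ) (M.step c γ') where
  dir_eq := by rw [dir_step_of_signature_eq_none h1, dir_step_of_signature_eq_none h2, h.dir_eq]
  cells τ := by
    rw [zipper_step_of_signature_eq_none h1, zipper_step_of_signature_eq_none h2]
    exact h.cells τ
  state_eq := hst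

/-- The signature contains the new state, so the states agree afterwards even if k was visible
before. -/
theorem step_some (h : AgreeOff k s γ γ') (hγ : γ.WellFormed) (hγ' : γ'.WellFormed) {c : C}
    {a : A} {g : Fin t → Bool × Bool} (h1 : M.signature c γ = some (a, g))
    (h2 : M.signature c γ' = some (a, g))
    (hw : ¬ s.view.Occurs k → γ.written c = γ'.written c) :
    AgreeOff k (s.next g) (M.step c γ) (M.step c γ') := by
  obtain ⟨-, s1, -, -, e1⟩ := step_of_signature_eq_some hγ h1
  obtain ⟨-, s2, -, -, e2⟩ := step_of_signature_eq_some hγ' h2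
  refine ⟨?_, ?_, fun _ => s1.trans s2.symm⟩
  · funext τ
    have d1 := (e1 τ).2
    have d2 := (e2 τ).2
    have d3 := congrFun h.dir_eq τ
    revert d1 d2 d3
    cases (M.step c γ).dir τ <;> cases (M.step c γ').dir τ <;> cases γ.dir τ <;>
      cases γ'.dir τ <;> simp
  · intro τ
    obtain ⟨z, z1, z2, z3, z4⟩ := h.cells τ
    refine ⟨z.write (γ.written c, γ'.written c, s.view) (g τ), ?_, ?_, ?_, ?_⟩
    · rw [(e1 τ).1, z1, Zipper.map_write]
    · rw [(e2 τ).1, z2, Zipper.map_write]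
    · rw [Zipper.map_write, ← z3]
      rfl
    · intro x hx
      rcases Zipper.mem_write hx with rfl | hx
      · exact hw
      · exact z4 x hx

theorem init {u v : Fin m → I} (h : ∀ l, l ≠ k → u l = v l) :
    AgreeOff k (Shadow.init m r t) (M.init u) (M.init v) where
  dir_eq := rfl
  state_eq _ := rfl
  cells τ := by
    refine ⟨([], if (τ : ℕ) = 0 then
      List.ofFn fun l => ([LMSymbol.langle, LMSymbol.input (u l), LMSymbol.rangle],
        [LMSymbol.langle, LMSymbol.input (v l), LMSymbol.rangle],
        fun κ => if κ = fun _ => none then some l else none)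
    else [([LMSymbol.langle, LMSymbol.rangle], [LMSymbol.langle, LMSymbol.rangle],
        fun _ => none)]), ?_, ?_, ?_, ?_⟩
    · rw [zipper_init]
      split_ifs <;> simp [Zipper.map, Function.comp_def]
    · rw [zipper_init]
      split_ifs <;> simp [Zipper.map, Function.comp_def]
    · simp only [Shadow.init]
      split_ifs <;> simp [Zipper.map, Function.comp_def]
    · rintro x (hx | hx) hk
      · simp at hx
      · dsimp only at hx
        split_ifs at hx
        · obtain ⟨l, rfl⟩ := List.mem_ofFn.1 hx
          dsimp only at hk ⊢
          rw [h l]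
          rintro rfl
          exact hk ⟨fun _ => none, if_pos rfl⟩
        · rw [List.mem_singleton.1 hx]

end AgreeOff

/-- The cell under the heads at time `j` is written at some later time, or still under the heads
in the end. -/
theorem view_mem_hist {σ : ℕ → Option (A × (Fin t → Bool × Bool))} {j L : ℕ} (h : j ≤ L) :
    (shadowRun m r σ j).view ∈ (shadowRun m r σ L).view :: (shadowRun m r σ L).hist := by
  induction L, h using Nat.le_induction with
  | base => simp
  | succ L _ ih =>
    rcases hL : σ L with _ | ⟨a, g⟩
    · rwa [shadowRun_succ_of_none hL]
    · rw [shadowRun_succ_of_some hL]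
      exact List.mem_cons_of_mem _ ih

/-- If the trajectories on `v` and on `w` have the same signatures, and no head configuration sees
both input positions `i` and `i'`, then an input `u` that agrees with `v` off `i'` and with `w` off
`i` leads to the state of `v` or of `w`. -/
theorem state_traj_of_mixed_input {c : ℕ → C} (hm : 0 < m) {u v w : Fin m → I} {i i' : Fin m}
    (huv : ∀ l, l ≠ i' → u l = v l) (huw : ∀ l, l ≠ i → u l = w l) {L : ℕ}
    (hσ : ∀ j < L, M.signatures c (M.init v) j = M.signatures c (M.init w) j)
    (hr : ∀ j, (shadowRun m r (M.signatures c (M.init v)) j).phase < r)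
    (hn : ∀ x ∈ (shadowRun m r (M.signatures c (M.init v)) L).view ::
      (shadowRun m r (M.signatures c (M.init v)) L).hist, ¬ (x.Occurs i ∧ x.Occurs i')) :
    (M.traj c (M.init u) L).state = (M.traj c (M.init v) L).state ∨
      (M.traj c (M.init u) L).state = (M.traj c (M.init w) L).state := by
  have hwf : ∀ (v : Fin m → I) j, (M.traj c (M.init v) j).WellFormed :=
    fun v j => wellFormed_traj (M.wellFormed_init hm v) j
  have key : ∀ j ≤ L, AgreeOff i' (shadowRun m r (M.signatures c (M.init v)) j)
      (M.traj c (M.init u) j) (M.traj c (M.init v) j) ∧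
      AgreeOff i (shadowRun m r (M.signatures c (M.init v)) j)
      (M.traj c (M.init u) j) (M.traj c (M.init w) j) := by
    intro j
    induction j with
    | zero => exact fun _ => ⟨AgreeOff.init huv, AgreeOff.init huw⟩
    | succ j ih =>
      intro hj
      obtain ⟨hv, hw⟩ := ih (by omega)
      have hs := ordered_shadowRun hr j
      have ev := fun h => hv.step_eq (M := M) hs (hr j) (hwf u j) (hwf v j) h (c j)
      have ew := fun h => hw.step_eq (M := M) hs (hr j) (hwf u j) (hwf w j) h (c j)
      have hvw := hσ j hj
      -- At most one of the two positions is visible, so u takes the step of v or that of w, and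
      -- these have equal signatures.
      have hu : M.signatures c (M.init u) j = M.signatures c (M.init v) j := by
        by_cases h : (shadowRun m r (M.signatures c (M.init v)) j).view.Occurs i'
        · have h' : ¬ (shadowRun m r (M.signatures c (M.init v)) j).view.Occurs i :=
            fun h' => hn _ (view_mem_hist (by omega)) ⟨h', h⟩
          rw [hvw]
          exact (ew h').1
        · exact (ev h).1
      rcases hc : M.signatures c (M.init v) j with _ | ⟨a, g⟩
      · rw [shadowRun_succ_of_none hc]
        exact ⟨hv.step_none (hu.trans hc) hc fun h => (ev h).2.1,
          hw.step_none (hu.trans hc) (hvw.symm.trans hc) fun h => (ew h).2.1⟩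
      · rw [shadowRun_succ_of_some hc]
        exact ⟨hv.step_some (hwf u j) (hwf v j) (hu.trans hc) hc fun h => (ev h).2.2,
          hw.step_some (hwf u j) (hwf w j) (hu.trans hc) (hvw.symm.trans hc)
            fun h => (ew h).2.2⟩
  obtain ⟨hv, hw⟩ := key L le_rfl
  by_cases h : (shadowRun m r (M.signatures c (M.init v)) L).view.Occurs i'
  · exact Or.inr (hw.state_eq fun h' => hn _ (view_mem_hist le_rfl) ⟨h', h⟩)
  · exact Or.inl (hv.state_eq h)

end NLM

/-! ### Acceptance probability and fixing the choices -/

namespace NLM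

variable {t m : ℕ} {I C A : Type*} {M : NLM t m I C A}

open scoped Classical in
/-- The probability that a random trajectory of length `L` from `γ` ends in an accepting state. -/
noncomputable def acceptWithin (M : NLM t m I C A) [Fintype C] : ℕ → LMConfig t I C A → ℝ≥0∞
  | 0, γ => if γ.state ∈ M.acc then 1 else 0
  | L + 1, γ => (∑ c, acceptWithin M L (M.step c γ)) / (Fintype.card C : ℝ≥0∞)

theorem stepProb_eq [Fintype C] {γ γ' : LMConfig t I C A} :
    M.stepProb γ γ' = (∑ c, open scoped Classical in
      if M.IsSucc c γ γ' then (1 : ℝ≥0∞) else 0) / (Fintype.card C : ℝ≥0∞) := by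
  classical
  rw [stepProb, Nat.card_eq_fintype_card, Set.ncard_eq_toFinset_card', Finset.sum_boole]
  simp

/-- The sequence `ρ` of steps leads from `γ` to an accepting configuration. -/
def IsAcceptingPath (M : NLM t m I C A) (γ : LMConfig t I C A) (ρ : List (LMConfig t I C A)) :
    Prop :=
  ρ.head? = some γ ∧ ρ.IsChain (fun γ γ' => ∃ c, M.IsSucc c γ γ') ∧
    ∃ γ', ρ.getLast? = some γ' ∧ γ'.state ∈ M.acc

theorem IsAcceptingPath.cases {γ : LMConfig t I C A} {ρ : List (LMConfig t I C A)}
    (h : M.IsAcceptingPath γ ρ) :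
    (γ.state ∈ M.acc ∧ ρ = [γ]) ∨
      ∃ c ρ', γ.state ∉ M.final ∧ ρ = γ :: M.step c γ :: ρ' ∧
        M.IsAcceptingPath (M.step c γ) (M.step c γ :: ρ') := by
  obtain ⟨h1, h2, γ', h3, h4⟩ := h
  rcases ρ with _ | ⟨γ₁, _ | ⟨γ₂, ρ⟩⟩
  · simp at h1
  · obtain rfl : γ₁ = γ := by simpa using h1
    simp only [List.getLast?_singleton, Option.some.injEq] at h3
    exact Or.inl ⟨h3 ▸ h4, rfl⟩
  · obtain rfl : γ₁ = γ := by simpa using h1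
    rw [List.isChain_cons_cons] at h2
    obtain ⟨⟨c, hc⟩, h2⟩ := h2
    obtain ⟨hf, rfl⟩ := isSucc_iff.1 hc
    exact Or.inr ⟨c, ρ, hf, rfl, rfl, h2, γ', by simpa using h3, h4⟩

section

variable [Fintype C] [Nonempty C]

theorem acceptWithin_of_acc {γ : LMConfig t I C A} (h : γ.state ∈ M.acc) (L : ℕ) :
    M.acceptWithin L γ = 1 := by
  induction L with
  | zero => simp [acceptWithin, h]
  | succ L ih =>
    simp only [acceptWithin, step_of_final (M.acc_subset h), ih]
    simp [ENNReal.div_self]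

/-- The accepting runs of length at most `L + 1` from `γ` have total probability at most
`acceptWithin L γ`. -/
theorem sum_runProb_le (L : ℕ) (γ : LMConfig t I C A) (S : Finset (List (LMConfig t I C A)))
    (hS : ∀ ρ ∈ S, ρ.length ≤ L + 1 ∧ M.IsAcceptingPath γ ρ) :
    ∑ ρ ∈ S, M.runProb ρ ≤ M.acceptWithin L γ := by
  classical
  induction L generalizing γ S with
  | zero =>
    have : S ⊆ if γ.state ∈ M.acc then {[γ]} else ∅ := by
      intro ρ hρ
      rcases (hS ρ hρ).2.cases with ⟨h, rfl⟩ | ⟨c, ρ', -, rfl, -⟩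
      · simp [h]
      · have := (hS _ hρ).1
        simp at this
    refine (Finset.sum_le_sum_of_subset this).trans ?_
    unfold acceptWithin
    split_ifs <;> simp [runProb]
  | succ L ih =>
    by_cases hacc : γ.state ∈ M.acc
    · rw [acceptWithin_of_acc hacc]
      have : S ⊆ {[γ]} := by
        intro ρ hρ
        rcases (hS ρ hρ).2.cases with ⟨-, rfl⟩ | ⟨c, ρ', hf, -⟩
        · simp
        · exact absurd (M.acc_subset hacc) hf
      refine (Finset.sum_le_sum_of_subset this).trans ?_
      simp [runProb]
    have hS' : ∀ ρ ∈ S, ∃ c ρ', γ.state ∉ M.final ∧ ρ = γ :: M.step c γ :: ρ' ∧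
        M.IsAcceptingPath (M.step c γ) (M.step c γ :: ρ') := fun ρ hρ =>
      (hS ρ hρ).2.cases.resolve_left fun h => hacc h.1
    -- The first step's probability becomes an average over choices, those that lead to the second
    -- configuration of ρ counting 1; the sums over runs and choices can then be exchanged.
    have hprob : ∀ ρ ∈ S, M.runProb ρ = (∑ c, if ρ.tail.head? = some (M.step c γ) then
        M.runProb ρ.tail else 0) / (Fintype.card C : ℝ≥0∞) := by
      intro ρ hρ
      obtain ⟨c, ρ', hf, rfl, -⟩ := hS' ρ hρ
      have : M.runProb (γ :: M.step c γ :: ρ') =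
          M.stepProb γ (M.step c γ) * M.runProb (M.step c γ :: ρ') := by
        simp [runProb]
      rw [this, stepProb_eq, ENNReal.mul_div_right_comm.symm, Finset.sum_mul]
      congr 1
      refine Finset.sum_congr rfl fun c _ => ?_
      simp [isSucc_iff, hf]
    rw [Finset.sum_congr rfl hprob, acceptWithin]
    simp only [div_eq_mul_inv]
    rw [← Finset.sum_mul, Finset.sum_comm]
    gcongr with c
    rw [← Finset.sum_filter]
    refine le_trans (le_of_eq ?_) (ih (M.step c γ)
      ((S.filter fun ρ => ρ.tail.head? = some (M.step c γ)).image List.tail) ?_)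
    · rw [Finset.sum_image]
      intro ρ hρ ρ' hρ' h
      obtain ⟨_, _, -, rfl, -⟩ := hS' ρ (Finset.mem_filter.1 hρ).1
      obtain ⟨_, _, -, rfl, -⟩ := hS' ρ' (Finset.mem_filter.1 hρ').1
      simpa using h
    · intro ρ hρ
      obtain ⟨ρ₀, h0, rfl⟩ := Finset.mem_image.1 hρ
      obtain ⟨h0, h1⟩ := Finset.mem_filter.1 h0
      obtain ⟨c', ρ', -, rfl, h2⟩ := hS' _ h0
      have h3 := (hS _ h0).1
      refine ⟨by simpa using h3, ?_⟩
      have : M.step c' γ = M.step c γ := by simpa using h1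
      rw [← this]
      exact h2

open scoped Classical in
/-- Some choice sequence does at least as well as the average on a family of configurations. -/
theorem exists_choices_sum_acceptWithin_le {J : Type*} (s : Finset J) (L : ℕ)
    (γ : J → LMConfig t I C A) :
    ∃ c : ℕ → C, ∑ x ∈ s, M.acceptWithin L (γ x) ≤
      ((s.filter fun x => (M.traj c (γ x) L).state ∈ M.acc).card : ℝ≥0∞) := by
  induction L generalizing γ with
  | zero =>
    refine ⟨fun _ => Classical.arbitrary C, ?_⟩
    simp only [acceptWithin, traj, Finset.sum_boole]
    exact le_of_eq (by congr)
  | succ L ih =>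
    -- The best first choice is at least as good as the average.
    obtain ⟨c₀, -, h₀⟩ := Finset.exists_max_image (Finset.univ : Finset C)
      (fun c => ∑ x ∈ s, M.acceptWithin L (M.step c (γ x))) Finset.univ_nonempty
    obtain ⟨c, hc⟩ := ih fun x => M.step c₀ (γ x)
    refine ⟨fun i => Nat.casesOn i c₀ c, ?_⟩
    simp only [traj_succ]
    refine le_trans ?_ hc
    simp only [acceptWithin, div_eq_mul_inv]
    rw [← Finset.sum_mul, Finset.sum_comm, ← div_eq_mul_inv]
    refine ENNReal.div_le_of_le_mul ?_
    refine (Finset.sum_le_sum fun c hc => h₀ c hc).trans ?_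
    rw [Finset.sum_const, Finset.card_univ, nsmul_eq_mul, mul_comm]

end

theorem exists_traj_of_isChain [Nonempty C] {γ : LMConfig t I C A}
    {ρ : List (LMConfig t I C A)} (h0 : ρ.head? = some γ)
    (hρ : ρ.IsChain (fun γ γ' => ∃ c, M.IsSucc c γ γ')) :
    ∃ c : ℕ → C, ∀ j, j + 1 < ρ.length → (M.traj c γ j).state ∉ M.final := by
  induction ρ generalizing γ with
  | nil => simp at h0
  | cons γ₁ ρ ih =>
    obtain rfl : γ₁ = γ := by simpa using h0
    rcases ρ with _ | ⟨γ₂, ρ⟩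
    · exact ⟨fun _ => Classical.arbitrary C, by simp⟩
    · rw [List.isChain_cons_cons] at hρ
      obtain ⟨⟨c₀, hc⟩, h⟩ := hρ
      obtain ⟨c, ih⟩ := ih rfl h
      obtain ⟨hf, rfl⟩ := isSucc_iff.1 hc
      refine ⟨fun i => Nat.casesOn i c₀ c, ?_⟩
      rintro (_ | j) hj
      · exact hf
      · rw [traj_succ]
        exact ih j (by simpa using hj)

theorem acceptProb_le [Fintype C] [Nonempty C] (v : Fin m → I) {L : ℕ}
    (hL : ∀ c : ℕ → C, (M.traj c (M.init v) L).state ∈ M.final) :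
    M.acceptProb v ≤ M.acceptWithin L (M.init v) := by
  rw [acceptProb, ENNReal.tsum_eq_iSup_sum]
  refine iSup_le fun S => ?_
  have := M.sum_runProb_le L (M.init v) (S.map (Function.Embedding.subtype _)) ?_
  · simpa using this
  · intro ρ hmem
    obtain ⟨⟨ρ, hρ⟩, -, rfl⟩ := Finset.mem_map.1 hmem
    refine ⟨?_, hρ.1.1, hρ.1.2.1, hρ.2⟩
    -- A longer run would follow a choice sequence that is not final after L steps.
    obtain ⟨c, hc⟩ := exists_traj_of_isChain hρ.1.1 hρ.1.2.1
    by_contra h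
    exact hc L (not_le.1 h) (hL c)

theorem runProb_ne_zero [Finite C] {ρ : List (LMConfig t I C A)}
    (hρ : ρ.IsChain (fun γ γ' => ∃ c, M.IsSucc c γ γ')) : M.runProb ρ ≠ 0 := by
  induction ρ with
  | nil => simp [runProb]
  | cons γ ρ ih =>
    rcases ρ with _ | ⟨γ', ρ⟩
    · simp [runProb]
    · rw [List.isChain_cons_cons] at hρ
      obtain ⟨⟨c, hc⟩, h⟩ := hρ
      have e : M.runProb (γ :: γ' :: ρ) = M.stepProb γ γ' * M.runProb (γ' :: ρ) := by
        simp [runProb]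
      rw [e]
      refine mul_ne_zero ?_ (ih h)
      refine ENNReal.div_ne_zero.2 ⟨?_, by simp⟩
      rw [Nat.cast_ne_zero]
      exact (Set.ncard_pos (Set.toFinite _)).2 ⟨c, hc⟩ |>.ne'

theorem acceptProb_ne_zero [Finite C] {v : Fin m → I} {ρ : List (LMConfig t I C A)}
    (h : M.IsAcceptingRun v ρ) : M.acceptProb v ≠ 0 := by
  intro h0
  rw [acceptProb, ENNReal.tsum_eq_zero] at h0
  exact runProb_ne_zero h.1.2.1 (h0 ⟨ρ, h⟩)

theorem exists_isAcceptingRun {v : Fin m → I} (h : M.acceptProb v ≠ 0) :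
    ∃ ρ, M.IsAcceptingRun v ρ := by
  by_contra! h'
  have : IsEmpty {ρ : List (LMConfig t I C A) // M.IsAcceptingRun v ρ} := ⟨fun ρ => h' _ ρ.2⟩
  simp [acceptProb] at h

theorem IsBounded.acceptProb_ne_zero_of_traj [Finite C] {r t' : ℕ} (hM : M.IsBounded r t')
    {c : ℕ → C} {v : Fin m → I} {L : ℕ} (h : (M.traj c (M.init v) L).state ∈ M.acc) :
    M.acceptProb v ≠ 0 := by
  obtain ⟨T, hT, hl⟩ := hM.exists_final c v
  have hTL : M.traj c (M.init v) L = M.traj c (M.init v) T := by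
    rcases le_total T L with h' | h'
    · exact traj_of_final hT h'
    · rw [← traj_of_final (M.acc_subset h) h']
  refine acceptProb_ne_zero ⟨isRun_of_final hT hl, M.traj c (M.init v) T, ?_, hTL ▸ h⟩
  simp [List.range_succ]

/-- Without choices there are no steps, and the initial state does not depend on the input. -/
theorem acceptProb_ne_zero_of_isEmpty [IsEmpty C] {u v : Fin m → I} (h : M.acceptProb v ≠ 0) :
    M.acceptProb u ≠ 0 := by
  obtain ⟨ρ, hρ⟩ := exists_isAcceptingRun h
  rcases IsAcceptingPath.cases ⟨hρ.1.1, hρ.1.2.1, hρ.2⟩ with ⟨h, -⟩ | ⟨c, -⟩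
  · exact acceptProb_ne_zero (ρ := [M.init u])
      ⟨⟨by simp, by simp, M.init u, by simp, M.acc_subset h⟩, M.init u, by simp, h⟩
  · exact isEmptyElim c

end NLM

/-! ### Counting signature sequences -/

namespace NLM

variable {t m : ℕ} {I C A : Type*} {M : NLM t m I C A}

/-- The g+1 configurations from the start of the gap to time j have pairwise different states. -/
theorem IsBounded.gap_lt {r t' : ℕ} (hM : M.IsBounded r t') [Finite A] {c : ℕ → C}
    {v : Fin m → I} {j g : ℕ} (hg : g ≤ j) (hj : M.signatures c (M.init v) j ≠ none)
    (h : ∀ i, j - g ≤ i → i < j → M.signatures c (M.init v) i = none) : g < Nat.card A := by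
  have := Fintype.ofFinite A
  have hf : ∀ l ≤ j, (M.traj c (M.init v) l).state ∉ M.final := by
    intro l hl hl'
    refine hj (signature_of_final ?_)
    rwa [traj_of_final hl' hl]
  have hne : ∀ i i', i < i' → i' ≤ g → (M.traj c (M.init v) (j - g + i)).state ≠
      (M.traj c (M.init v) (j - g + i')).state := fun i i' h1 h2 =>
    hM.state_ne (by omega) (fun l hl => hf l (by omega)) fun l h3 h4 => h l (by omega) (by omega)
  have hinj : Set.InjOn (fun i => (M.traj c (M.init v) (j - g + i)).state)
      (Finset.range (g + 1)) := by
    intro i hi i' hi' heq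
    rw [Finset.mem_coe, Finset.mem_range] at hi hi'
    rcases lt_trichotomy i i' with h' | h' | h'
    · exact absurd heq (hne i i' h' (by omega))
    · exact h'
    · exact absurd heq.symm (hne i' i h' (by omega))
  have := Finset.card_le_card_of_injOn (t := (Finset.univ : Finset A)) _ (fun _ _ => by simp) hinj
  rw [Finset.card_range, Finset.card_univ, ← Nat.card_eq_fintype_card] at this
  omega

/-- The number of sequences of signatures is bounded. -/
theorem IsBounded.exists_code {r t' : ℕ} (hM : M.IsBounded r t') (hm : 0 < m) (ht : 2 ≤ t)
    [Finite A] (c : ℕ → C) (L : ℕ) :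
    ∃ (f : (Fin m → I) → Fin ((t + 1) ^ r * (m + t)) → Option (ℕ × A × (Fin t → Bool × Bool)))
      (T : Finset (Fin ((t + 1) ^ r * (m + t)) → Option (ℕ × A × (Fin t → Bool × Bool)))),
      (∀ v, f v ∈ T) ∧
      T.card = (Nat.card A * (Nat.card A * 4 ^ t) + 1) ^ ((t + 1) ^ r * (m + t)) ∧
      ∀ v w, f v = f w →
        ∀ j < L, M.signatures c (M.init v) j = M.signatures c (M.init w) j := by
  classical
  have := Fintype.ofFinite A
  have hlen : ∀ v, (encodeGaps (M.signatures c (M.init v)) L 0 0).length ≤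
      (t + 1) ^ r * (m + t) := by
    intro v
    have h1 := length_encodeGaps m r (M.signatures c (M.init v)) L 0 0
    have h2 := hM.hist_length_le hm ht c v (0 + L)
    omega
  -- Slots past the end of the code hold `none`, whence the +1 in the base.
  refine ⟨fun v i => (encodeGaps (M.signatures c (M.init v)) L 0 0)[(i : ℕ)]?,
    Fintype.piFinset fun _ => Finset.insertNone (Finset.range (Nat.card A) ×ˢ Finset.univ),
    ?_, ?_, ?_⟩
  · intro v
    rw [Fintype.mem_piFinset]
    intro i
    rw [Finset.mem_insertNone]
    intro x hx
    obtain ⟨j, h1, -, h3, h4⟩ := exists_of_mem_encodeGaps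
      (List.mem_of_getElem? (Option.mem_def.1 hx)) le_rfl (by simp)
    simpa using hM.gap_lt h1 (by simp [h3]) h4
  · simp [Fintype.card_piFinset, Finset.card_product, Nat.card_eq_fintype_card]
  · intro v w hvw j hj
    have : encodeGaps (M.signatures c (M.init v)) L 0 0 =
        encodeGaps (M.signatures c (M.init w)) L 0 0 := by
      refine List.ext_getElem? fun i => ?_
      by_cases hi : i < (t + 1) ^ r * (m + t)
      · exact congrFun hvw ⟨i, hi⟩
      · rw [List.getElem?_eq_none ((hlen v).trans (not_lt.1 hi)),
          List.getElem?_eq_none ((hlen w).trans (not_lt.1 hi))]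
    simpa using encodeGaps_injective this j hj

end NLM

/-! ### Interval elements and numerical estimates -/

/-- The `x`-th element of the `j`-th interval of length `q`. -/
def intervalElement (n q : ℕ) (j x : ℕ) : BitVec n := BitVec.ofNat n (j * q + x)

section IntervalElement

variable {n m q : ℕ}

theorem toNat_intervalElement (h : 2 ^ n = m * q) (j : Fin m) (x : Fin q) :
    (intervalElement n q j x).toNat = j * q + x := by
  rw [intervalElement, BitVec.toNat_ofNat, Nat.mod_eq_of_lt]
  rw [h]
  calc (j : ℕ) * q + x < j * q + q := by omega
    _ = (j + 1) * q := by ring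
    _ ≤ m * q := Nat.mul_le_mul_right _ j.2

theorem intervalElement_mem (h : 2 ^ n = m * q) (j : Fin m) (x : Fin q) :
    intervalElement n q j x ∈ inputInterval n m j := by
  have hx := x.2
  have hm : 0 < m := j.pos
  simp only [inputInterval, Set.mem_ofPred_eq, toNat_intervalElement h, h]
  constructor <;> nlinarith

theorem intervalElement_injective (h : 2 ^ n = m * q) (j : Fin m) {x y : Fin q}
    (hxy : intervalElement n q j x = intervalElement n q j y) : x = y := by
  have := congrArg BitVec.toNat hxy
  rw [toNat_intervalElement h, toNat_intervalElement h] at this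
  exact Fin.ext (by omega)

end IntervalElement

section Arithmetic

variable {k m n r t : ℕ}

/-- With B = (t+1)^(2r), the bound on m gives 2B ≤ √m, so B·s ≤ B(2√m - 1) ≤ m - B < m. -/
theorem colors_mul_lt {s : ℕ} (hm : 24 * (t + 1) ^ (4 * r) + 1 ≤ m)
    (hs : (s : ℝ) ≤ 2 * Real.sqrt (m : ℝ) - 1) : ((t + 1) ^ r) ^ 2 * s < m := by
  have e : (t + 1) ^ (4 * r) = (((t + 1) ^ r) ^ 2) ^ 2 := by ring
  rw [e] at hm
  have hB : 1 ≤ ((t + 1) ^ r) ^ 2 := Nat.one_le_pow _ _ (by positivity)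
  generalize ((t + 1) ^ r) ^ 2 = B at *
  have hm' : 24 * (B : ℝ) ^ 2 + 1 ≤ m := by exact_mod_cast hm
  have hB' : (1 : ℝ) ≤ B := by exact_mod_cast hB
  have h1 : 2 * (B : ℝ) ≤ Real.sqrt m := Real.le_sqrt_of_sq_le (by nlinarith)
  have h2 : Real.sqrt m * Real.sqrt m = m := Real.mul_self_sqrt (by positivity)
  have : (B : ℝ) * s < m := by nlinarith [mul_le_mul_of_nonneg_left hs (by linarith : (0 : ℝ) ≤ B)]
  exact_mod_cast this

theorem two_mul_pow_le_two_pow (hk : 0 < k)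
    (hn : 1 + ((m : ℝ) ^ 2 + 1) * Real.logb 2 (2 * (k : ℝ)) ≤ (n : ℝ)) :
    2 * (2 * k) ^ (m ^ 2 + 1) ≤ 2 ^ n := by
  have hk' : (0 : ℝ) < 2 * k := by positivity
  have h : Real.logb 2 (2 * (2 * (k : ℝ)) ^ (m ^ 2 + 1)) ≤ n := by
    rw [Real.logb_mul (by norm_num) (by positivity), Real.logb_pow,
      Real.logb_self_eq_one (by norm_num)]
    push_cast
    exact hn
  rw [Real.logb_le_iff_le_rpow (by norm_num) (by positivity), Real.rpow_natCast] at h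
  exact_mod_cast h

/-- Each slot has at most (2k)^(t+2) values, and (t+2)(t+1)^r(2m+t) ≤ 6(t+1)^(r+1)m ≤ m². -/
theorem codes_le {K : ℕ} (hr : 0 < r) (ht : 2 ≤ t) (hm : 24 * (t + 1) ^ (4 * r) + 1 ≤ m)
    (hk : 2 * m + 3 ≤ k) (hK : K ≤ k) :
    (K * (K * 4 ^ t) + 1) ^ ((t + 1) ^ r * (2 * m + t)) ≤ (2 * k) ^ (m ^ 2) := by
  have h1 : K * (K * 4 ^ t) + 1 ≤ (2 * k) ^ (t + 2) := by
    have e : (4 : ℕ) ^ t = 2 ^ t * 2 ^ t := by rw [← mul_pow]; norm_num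
    have h2 : 2 ^ t ≤ k ^ t := Nat.pow_le_pow_left (by omega) t
    have h3 : K * K ≤ k * k := Nat.mul_le_mul hK hK
    have h4 : 1 ≤ 2 ^ t * k ^ t * (k * k) := Nat.one_le_iff_ne_zero.2 (by
      have : k ≠ 0 := by omega
      positivity)
    calc K * (K * 4 ^ t) + 1 = 2 ^ t * 2 ^ t * (K * K) + 1 := by rw [e]; ring
      _ ≤ 2 ^ t * k ^ t * (k * k) + 1 := by gcongr
      _ ≤ 4 * (2 ^ t * k ^ t * (k * k)) := by omega
      _ = (2 * k) ^ (t + 2) := by ring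
  have htm : t + 1 ≤ m := by
    have : t + 1 ≤ (t + 1) ^ (4 * r) := Nat.le_self_pow (by omega) _
    omega
  have h2 : (t + 2) * ((t + 1) ^ r * (2 * m + t)) ≤ m ^ 2 := by
    have h5 : (t + 1) ^ (r + 1) ≤ (t + 1) ^ (4 * r) := Nat.pow_le_pow_right (by omega) (by omega)
    calc (t + 2) * ((t + 1) ^ r * (2 * m + t)) ≤ (2 * (t + 1)) * ((t + 1) ^ r * (3 * m)) := by
          gcongr <;> omega
      _ = 6 * (t + 1) ^ (r + 1) * m := by ring
      _ ≤ m * m := Nat.mul_le_mul_right _ (by omega)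
      _ = m ^ 2 := (sq m).symm
  calc _ ≤ ((2 * k) ^ (t + 2)) ^ ((t + 1) ^ r * (2 * m + t)) := Nat.pow_le_pow_left h1 _
    _ = (2 * k) ^ ((t + 2) * ((t + 1) ^ r * (2 * m + t))) := (pow_mul _ _ _).symm
    _ ≤ _ := Nat.pow_le_pow_right (by omega) h2

end Arithmetic

/-! ### Pigeonhole and conclusion -/

namespace NLM

variable {t m : ℕ} {I C A : Type*} {M : NLM t m I C A}

/-- Only few pairs of input positions `a i` and `b (φ i)` are seen by the heads at the same time. -/
theorem IsBounded.exists_not_occurs {r t' m' : ℕ} (hM : M.IsBounded r t') (hm : 0 < m)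
    (c : ℕ → C) (v : Fin m → I) (L : ℕ) (φ : Equiv.Perm (Fin m')) {a b : Fin m' → Fin m}
    (ha : StrictMono a) (hb : StrictMono b) (hφ : ((t + 1) ^ r) ^ 2 * sortedness φ < m') :
    ∃ i, ∀ x ∈ (shadowRun m r (M.signatures c (M.init v)) L).view ::
      (shadowRun m r (M.signatures c (M.init v)) L).hist,
        ¬ (x.Occurs (a i) ∧ x.Occurs (b (φ i))) := by
  classical
  by_contra! h
  have hr := hM.phase_lt hm c v
  have hs := ordered_shadowRun hr L
  have := card_common_cell_le (fun κ => hs.hist_view_sorted (hr L) κ) φ ha hb Finset.univ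
    fun i _ => by
      obtain ⟨x, hx, h1, h2⟩ := h i
      exact ⟨x, List.mem_reverse.2 hx, h1, h2⟩
  simp only [Finset.card_univ, Fintype.card_fin, Fintype.card_fun, Fintype.card_option] at this
  omega

/-- If there are many accepting trajectories on inputs `inp x x`, then there is one on an input
`inp x y` with `x ≠ y`, provided that the coordinate `φ i` of `x` occurs in `inp x y` only at
position `a i`, and that of `y` only at position `b (φ i)`. -/
theorem IsBounded.exists_mixed_accepted {r t' m' q L : ℕ} (hM : M.IsBounded r t') (hm : 0 < m)
    (ht : 2 ≤ t) [Finite A] (c : ℕ → C) (φ : Equiv.Perm (Fin m')) {a b : Fin m' → Fin m}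
    (ha : StrictMono a) (hb : StrictMono b) (hφ : ((t + 1) ^ r) ^ 2 * sortedness φ < m')
    (inp : (Fin m' → Fin q) → (Fin m' → Fin q) → Fin m → I)
    (hfst : ∀ x x' y i, (∀ j, j ≠ φ i → x j = x' j) →
      ∀ l, l ≠ a i → inp x y l = inp x' y l)
    (hsnd : ∀ x y y' j, (∀ j', j' ≠ j → y j' = y' j') →
      ∀ l, l ≠ b j → inp x y l = inp x y' l)
    (G : Finset (Fin m' → Fin q))
    (hG : ∀ x ∈ G, (M.traj c (M.init (inp x x)) L).state ∈ M.acc)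
    (hcard : (Nat.card A * (Nat.card A * 4 ^ t) + 1) ^ ((t + 1) ^ r * (m + t)) * q ^ (m' - 1) <
      G.card) :
    ∃ x y, x ≠ y ∧ (M.traj c (M.init (inp x y)) L).state ∈ M.acc := by
  classical
  obtain ⟨f, T, hfT, hT, hf⟩ := hM.exists_code hm ht c L
  rw [← hT] at hcard
  obtain ⟨z, -, hz⟩ := Finset.exists_lt_card_fiber_of_mul_lt_card_of_maps_to
    (f := fun x => f (inp x x)) (fun x _ => hfT _) hcard
  obtain ⟨x₀, hx₀⟩ := Finset.card_pos.1 ((Nat.zero_le _).trans_lt hz)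
  -- The shadow depends only on the signatures, so this i serves the whole class of x₀.
  obtain ⟨i, hi⟩ := hM.exists_not_occurs hm c (inp x₀ x₀) L φ ha hb hφ
  -- Forgetting coordinate φ i leaves q^(m'-1) possibilities, fewer than the class has members.
  have hlt : (Finset.univ : Finset ({j // j ≠ φ i} → Fin q)).card <
      (G.filter fun x => f (inp x x) = z).card := by
    refine lt_of_eq_of_lt ?_ hz
    simp [Fintype.card_subtype_compl]
  obtain ⟨x, hx, y, hy, hne, hxy⟩ := Finset.exists_ne_map_eq_of_card_lt_of_maps_to hlt
    (f := fun x (j : {j // j ≠ φ i}) => x j) (fun _ _ => Finset.mem_coe.2 (Finset.mem_univ _))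
  have hxy' : ∀ j, j ≠ φ i → x j = y j := fun j hj => congrFun hxy ⟨j, hj⟩
  rw [Finset.mem_filter] at hx hy hx₀
  refine ⟨x, y, hne, ?_⟩
  have hσ : ∀ j < L, M.signatures c (M.init (inp x x)) j =
      M.signatures c (M.init (inp x₀ x₀)) j := hf _ _ (hx.2.trans hx₀.2.symm)
  rcases state_traj_of_mixed_input (M := M) (c := c) (u := inp x y) (v := inp x x)
    (w := inp y y) (i := a i) (i' := b (φ i)) hm
    (hsnd x y x (φ i) fun j hj => (hxy' j hj).symm) (hfst x y y i hxy')
    (hf _ _ (hx.2.trans hy.2.symm)) (hM.phase_lt hm c _)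
    (by rwa [shadowRun_congr hσ]) with h | h
  · rw [h]
    exact hG x hx.1
  · rw [h]
    exact hG y hy.1

end NLM

theorem lemma21 (k m n r t : ℕ)
    (hm2 : ∃ l : ℕ, m = 2 ^ l)
    (ht : 2 ≤ t)
    (hm : 24 * (t + 1) ^ (4 * r) + 1 ≤ m)
    (hk : 2 * m + 3 ≤ k)
    (hn : 1 + ((m : ℝ) ^ 2 + 1) * Real.logb 2 (2 * (k : ℝ)) ≤ (n : ℝ))
    (φ : Equiv.Perm (Fin m))
    (hφ : (sortedness φ : ℝ) ≤ 2 * Real.sqrt (m : ℝ) - 1)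
    {C A : Type*} [Finite C] [Finite A] (hA : Nat.card A ≤ k)
    (M : NLM t (2 * m) (BitVec n) C A) (hM : M.IsBounded r t) :
    ¬ ∀ v v' : Fin m → BitVec n,
        (∀ i, v i ∈ inputInterval n m (φ i)) → (∀ j, v' j ∈ inputInterval n m j) →
          ((∀ i, v i = v' (φ i)) →
            1 / 2 ≤ M.acceptProb (fun i => Fin.append v v' (Fin.cast (two_mul m) i))) ∧
          (¬ (∀ i, v i = v' (φ i)) →
            M.acceptProb (fun i => Fin.append v v' (Fin.cast (two_mul m) i)) = 0) := by
  classical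
  intro H
  have hm0 : 0 < m := by omega
  have hmm : 0 < 2 * m := by omega
  have hpow := two_mul_pow_le_two_pow (m := m) (by omega) hn
  obtain ⟨q, hq⟩ : m ∣ 2 ^ n := by
    obtain ⟨l, rfl⟩ := hm2
    refine pow_dvd_pow 2 (le_of_lt ((Nat.pow_lt_pow_iff_right one_lt_two).1 (lt_of_lt_of_le ?_ hpow)))
    calc 2 ^ l < 2 * k := by omega
      _ ≤ (2 * k) ^ ((2 ^ l) ^ 2 + 1) := Nat.le_self_pow (by omega) _
      _ ≤ _ := Nat.le_mul_of_pos_left _ two_pos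
  -- Since m < 2k, one factor 2k in the bound on 2^n = m·q pays for m.
  have hqk : 2 * (2 * k) ^ (m ^ 2) < q := by
    refine lt_of_mul_lt_mul_left (a := m) ?_ (Nat.zero_le _)
    rw [← hq]
    refine lt_of_lt_of_le ?_ hpow
    have : 0 < (2 * k) ^ (m ^ 2) := by
      have : 0 < k := by omega
      positivity
    rw [pow_succ (2 * k)]
    nlinarith
  -- Coordinates are indexed by intervals, so the yes-instances are the diagonal inputs `inp x x`,
  -- and `inp x y` with x ≠ y is a no-instance.
  set inp : (Fin m → Fin q) → (Fin m → Fin q) → Fin (2 * m) → BitVec n := fun x y l =>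
    Fin.append (fun i => intervalElement n q (φ i) (x (φ i)))
      (fun j => intervalElement n q j (y j)) (Fin.cast (two_mul m) l) with hinp
  have hyes : ∀ x, 1 / 2 ≤ M.acceptProb (inp x x) := fun x =>
    (H _ _ (fun i => intervalElement_mem hq _ _) (fun j => intervalElement_mem hq _ _)).1
      fun i => rfl
  have hno : ∀ x y, x ≠ y → M.acceptProb (inp x y) = 0 := fun x y hxy =>
    (H _ _ (fun i => intervalElement_mem hq _ _) (fun j => intervalElement_mem hq _ _)).2
      fun h => hxy (funext fun j => by
        simpa using intervalElement_injective hq _ (h (φ.symm j)))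
  have hyes' : ∀ x, M.acceptProb (inp x x) ≠ 0 := fun x h => by
    have := hyes x
    rw [h] at this
    simp at this
  -- Averaging over choices needs a choice; without one, a yes-instance and a no-instance are
  -- treated alike.
  rcases isEmpty_or_nonempty C with hC | hC
  · have hq1 : 1 < q := lt_of_le_of_lt (by
      have := Nat.one_le_pow (m ^ 2) (2 * k) (by omega)
      omega) hqk
    have hne : (fun _ : Fin m => (⟨0, by omega⟩ : Fin q)) ≠ fun _ => ⟨1, hq1⟩ := fun h => by
      simpa using congrFun h ⟨0, hm0⟩
    exact NLM.acceptProb_ne_zero_of_isEmpty (hyes' fun _ => ⟨1, hq1⟩) (hno _ _ hne)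
  · have := Fintype.ofFinite C
    have hr : 0 < r := (Nat.zero_le _).trans_lt
      (hM.phase_lt hmm (fun _ => Classical.arbitrary C) (inp (fun _ => ⟨0, by omega⟩)
        fun _ => ⟨0, by omega⟩) 0)
    set L := ((t + 1) ^ r * (2 * m + t) + 1) * Nat.card A with hL
    obtain ⟨c, hc⟩ := M.exists_choices_sum_acceptWithin_le
      (Finset.univ : Finset (Fin m → Fin q)) L fun x => M.init (inp x x)
    set G := Finset.univ.filter fun x : Fin m → Fin q =>
      (M.traj c (M.init (inp x x)) L).state ∈ M.acc with hG
    have hGcard : q ^ m ≤ 2 * G.card := by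
      have h1 : ∑ _x : Fin m → Fin q, (1 / 2 : ℝ≥0∞) ≤ (G.card : ℝ≥0∞) := by
        refine (Finset.sum_le_sum fun x _ => ?_).trans hc
        exact (hyes x).trans (NLM.acceptProb_le _ fun c => hM.final_of_le hmm ht c _ le_rfl)
      rw [Finset.sum_const, Finset.card_univ, nsmul_eq_mul, one_div, ← div_eq_mul_inv,
        ENNReal.div_le_iff (by simp) (by simp)] at h1
      simp only [Fintype.card_fun, Fintype.card_fin] at h1
      rw [mul_comm]
      exact_mod_cast h1
    have hcodes := codes_le hr ht hm hk hA
    -- With S signature codes, 2S < q and q^m ≤ 2·|G| give S·q^(m-1) < |G|.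
    have hcard : (Nat.card A * (Nat.card A * 4 ^ t) + 1) ^ ((t + 1) ^ r * (2 * m + t)) *
        q ^ (m - 1) < G.card := by
      have h0 : 0 < q ^ (m - 1) := by
        have : 0 < q := by omega
        positivity
      have h1 : q ^ m = q * q ^ (m - 1) := by
        rw [← pow_succ', Nat.sub_add_cancel hm0]
      generalize (Nat.card A * (Nat.card A * 4 ^ t) + 1) ^ ((t + 1) ^ r * (2 * m + t)) = S at *
      nlinarith
    have hcast : ∀ l : Fin (2 * m), ∃ l', l = Fin.cast (two_mul m).symm l' :=
      fun l => ⟨Fin.cast (two_mul m) l, rfl⟩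
    obtain ⟨x, y, hxy, hacc⟩ := hM.exists_mixed_accepted (L := L) hmm ht c φ
      (a := fun i => Fin.cast (two_mul m).symm (Fin.castAdd m i))
      (b := fun j => Fin.cast (two_mul m).symm (Fin.natAdd m j))
      (fun i j h => h) (fun i j h => Nat.add_lt_add_left h m) (colors_mul_lt hm hφ) inp
      (by
        intro x x' y i hxx' l hl
        obtain ⟨l, rfl⟩ := hcast l
        simp only [hinp, Fin.cast_cast, Fin.cast_eq_self]
        induction l using Fin.addCases with
        | left i' =>
          have : i' ≠ i := by rintro rfl; exact hl rfl
          simp only [Fin.append_left]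
          rw [hxx' _ fun h => this (φ.injective h)]
        | right j => simp only [Fin.append_right])
      (by
        intro x y y' j hyy' l hl
        obtain ⟨l, rfl⟩ := hcast l
        simp only [hinp, Fin.cast_cast, Fin.cast_eq_self]
        induction l using Fin.addCases with
        | left i' => simp only [Fin.append_left]
        | right j' =>
          have : j' ≠ j := by rintro rfl; exact hl rfl
          simp only [Fin.append_right]
          rw [hyy' _ this])
      G (fun x hx => (Finset.mem_filter.1 hx).2) hcard
    exact hM.acceptProb_ne_zero_of_traj hacc (hno x y hxy)
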